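/- **Setting.** Let $M$ be an $n$-dimensional compact, path-connected $C^\infty$-manifold and let $\operatorname{Emb}(M,\mathbb R^{n+1})$ be the set of $C^\infty$-embeddings $M\to\mathbb R^{n+1}$ (injective smooth maps with everywhere injective derivative). For $V\in C^\infty(\mathbb R^{n+1},\mathbb R^{n+1})$ and $t\ge 0$ put $T_t(x)=x+tV(x)$ and $\varphi_t=\varphi+t\,V\circ\varphi$; for small $t$ this is again an embedding. All derivatives in $t$ at $t=0$ below are one-sided ($t\downarrow 0$). For a family $f:\operatorname{Emb}(M,\mathbb R^{n+1})\times\mathbb R^{n+1}\to\mathbb R$, written $f_\varphi(x)$, let $$\mathfrak D f(\varphi)[V](x)=\tfrac{\mathrm d}{\mathrm dt}\big|_{t=0}f_{\varphi_t}(x),\qquad \mathfrak D_m f(\varphi)[V](x)=\tfrac{\mathrm d}{\mathrm dt}\big|_{t=0}f_{\varphi_t}(T_t(x)).$$ The family $f$ is *pre-shape differentiable at $\varphi$* if for every $V\in C^\infty(\mathbb R^{n+1},\mathbb R^{n+1})$ the quotients $(f_{\varphi_t}-f_\varphi)/t$ converge as $t\downarrow0$ locally uniformly on $\mathbb R^{n+1}$,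 and the limit $\mathfrak Df(\varphi)[V](x)$ is, for each $x$, linear and bounded (continuous for the $C^\infty$-topology) in $V$. **Statement.** Let $f,g:\operatorname{Emb}(M,\mathbb R^{n+1})\times\mathbb R^{n+1}\to\mathbb R$ be pre-shape differentiable at $\varphi\in\operatorname{Emb}(M,\mathbb R^{n+1})$, with $f_\psi,g_\psi$ differentiable on $\mathbb R^{n+1}$ for all $\psi$; let $h:\mathbb R\to\mathbb R$ be differentiable and $V\in C^\infty(\mathbb R^{n+1},\mathbb R^{n+1})$. Then the material derivatives on the left-hand sides below exist at every point of $\mathbb R^{n+1}$ and 1. $\mathfrak D_m f(\varphi)[V]=\mathfrak D f(\varphi)[V]+\nabla f_\varphi^{T}V$; 2. $\mathfrak D_m(f\cdot g)(\varphi)[V]=\mathfrak D_mf(\varphi)[V]\cdot g_\varphi+f_\varphi\cdot\mathfrak D_mg(\varphi)[V]$; 3. $\mathfrak D_m(h\circ f)(\varphi)[V]=h'(f_\varphi)\,\mathfrak D_mf(\varphi)[V]$. If moreover $f_\varphi$ is locally Lipschitz (for example $C^1$), then 4. for every open bounded $\Omega\subset\mathbb R^{n+1}$ with Lipschitz boundary,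 $$\tfrac{\mathrm d}{\mathrm dt}\Big|_{t=0}\int_{T_t(\Omega)}f_{\varphi_t}\,\mathrm dx=\int_\Omega \mathfrak D_mf(\varphi)[V]+\operatorname{div}(V)\,f_\varphi\,\mathrm dx ;$$ 5. for every bounded $n$-dimensional embedded $C^\infty$-submanifold $\Gamma\subset\mathbb R^{n+1}$ (without boundary, not necessarily closed) of finite surface measure, in particular every compact one, $$\tfrac{\mathrm d}{\mathrm dt}\Big|_{t=0}\int_{T_t(\Gamma)}f_{\varphi_t}\,\mathrm ds=\int_\Gamma \mathfrak D_mf(\varphi)[V]+\operatorname{div}_\Gamma(V)\,f_\varphi\,\mathrm ds ,$$ where $\mathrm ds$ is $n$-dimensional surface (Hausdorff) measure and $\operatorname{div}_\Gamma(V)=\operatorname{tr}(P\,DV)$ with $P(x)$ the orthogonal projection onto $T_x\Gamma$. In 4 and 5 the functions $f_{\varphi_t}$ (for small $t\ge0$) and the integrands on the right are integrable, and the derivatives on the left exist. **Shape derivatives.** The same rules 1–5 hold, under the same hypotheses, for families $f,g:B_e\times\mathbb R^{n+1}\to\mathbb R$ indexed by the shape space $B_e=\operatorname{Emb}(M,\mathbb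 R^{n+1})/\operatorname{Diff}(M)$, with $\varphi$ replaced by a shape and $\varphi_t$ by the perturbed shape, i.e. the one with underlying set $\{x+tV(x):x \text{ in the shape}\}$ for small $t$. -/

import Mathlib

open Set Filter Topology MeasureTheory
open scoped Manifold ContDiff

noncomputable section

namespace PreShape

/-- The ambient space `ℝⁿ⁺¹` with its Euclidean norm. -/
abbrev Ambient (n : ℕ) : Type := EuclideanSpace ℝ (Fin (n + 1))

/-- The perturbation of identity `T_t(x) = x + t V(x)` of the ambient space. -/
def displace {n : ℕ} (V : Ambient n → Ambient n) (t : ℝ) (x : Ambient n) : Ambient n :=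
  x + t • V x

section Manifolds

variable {n : ℕ} {H : Type*} [TopologicalSpace H]
  (I : ModelWithCorners ℝ (EuclideanSpace ℝ (Fin n)) H)
  (M : Type*) [TopologicalSpace M] [ChartedSpace H M]

variable {M} in
/-- `φ` is a `C^∞`-embedding into `ℝⁿ⁺¹`: an injective smooth map whose derivative is injective at
every point. -/
structure IsEmb (φ : M → Ambient n) : Prop where
  contMDiff : ContMDiff I 𝓘(ℝ, Ambient n) ∞ φ
  injective : Function.Injective φ
  mfderiv_injective : ∀ p, Function.Injective (mfderiv I 𝓘(ℝ, Ambient n) φ p)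

/-- The pre-shape space `Emb(M, ℝⁿ⁺¹)`. -/
structure Emb where
  toFun : M → Ambient n
  isEmb : IsEmb I toFun

variable {I M}

theorem IsEmb.comp_diffeomorph [IsManifold I ∞ M] {φ : M → Ambient n} (hφ : IsEmb I φ)
    (ρ : M ≃ₘ^∞⟮I, I⟯ M) : IsEmb I (φ ∘ ρ) where
  contMDiff := hφ.contMDiff.comp ρ.contMDiff
  injective := hφ.injective.comp ρ.injective
  mfderiv_injective p := by
    rw [mfderiv_comp p (hφ.contMDiff.mdifferentiableAt (by simp))
      (ρ.contMDiff.mdifferentiableAt (by simp))]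
    exact (hφ.mfderiv_injective (ρ p)).comp
      (ρ.mfderivToContinuousLinearEquiv (by simp) p).injective

theorem isEmb_comp_diffeomorph_iff [IsManifold I ∞ M] {φ : M → Ambient n}
    (ρ : M ≃ₘ^∞⟮I, I⟯ M) : IsEmb I (φ ∘ ρ) ↔ IsEmb I φ := by
  refine ⟨fun h => ?_, fun h => h.comp_diffeomorph ρ⟩
  have h2 := h.comp_diffeomorph ρ.symm
  have h3 : (φ ∘ ρ) ∘ ρ.symm = φ := by
    funext p
    simp
  rwa [h3] at h2

namespace Emb

open Classical in
/-- The perturbation of identity `φ_t = φ + t V ∘ φ` of the pre-shape `φ` in direction `V`.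
For compact `M` and smooth `V` the map `φ + t V ∘ φ` is an embedding for all sufficiently small
`|t|` (see `eventually_perturb_apply`); for the other values of `t`, which are irrelevant for
derivatives at `t = 0`, the value is `φ` by convention. -/
def perturb (φ : Emb I M) (V : Ambient n → Ambient n) (t : ℝ) : Emb I M :=
  if h : IsEmb I (fun p => φ.toFun p + t • V (φ.toFun p)) then ⟨_, h⟩ else φ

/-- Close to `t = 0` the perturbation of identity is given by `φ_t = φ + t V ∘ φ`. -/
theorem eventually_perturb_apply [CompactSpace M] (φ : Emb I M)
    {V : Ambient n → Ambient n} (hV : ContDiff ℝ ∞ V) :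
    ∀ᶠ t in 𝓝 (0 : ℝ), ∀ p, (φ.perturb V t).toFun p = φ.toFun p + t • V (φ.toFun p) := by
  obtain ⟨R, hR⟩ := (isCompact_range φ.isEmb.contMDiff.continuous).isBounded.subset_closedBall 0
  obtain ⟨K, hK⟩ := (isCompact_closedBall (0 : Ambient n) R).exists_bound_of_continuousOn
    (hV.continuous_fderiv (by simp)).continuousOn
  have hK0 : ∀ᶠ t in 𝓝 (0 : ℝ), |t| * K < 1 := by
    have : Tendsto (fun t : ℝ => |t| * K) (𝓝 0) (𝓝 (|0| * K)) :=
      (continuous_abs.mul continuous_const).tendsto 0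
    exact this.eventually (gt_mem_nhds (by simp))
  filter_upwards [hK0] with t ht
  have hVd : Differentiable ℝ V := hV.differentiable (by simp)
  have mem (p : M) : φ.toFun p ∈ Metric.closedBall (0 : Ambient n) R := hR (mem_range_self p)
  have key : IsEmb I (fun p => φ.toFun p + t • V (φ.toFun p)) := by
    have hT : ContDiff ℝ ∞ (fun x : Ambient n => x + t • V x) :=
      contDiff_id.add (hV.const_smul t)
    refine ⟨hT.contMDiff.comp φ.isEmb.contMDiff, ?_, ?_⟩
    · intro p q hpq
      apply φ.isEmb.injective
      have h1 : ‖V (φ.toFun q) - V (φ.toFun p)‖ ≤ K * ‖φ.toFun q - φ.toFun p‖ :=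
        (convex_closedBall (0 : Ambient n) R).norm_image_sub_le_of_norm_fderiv_le
          (fun x _ => hVd x) hK (mem p) (mem q)
      have h2 : φ.toFun q - φ.toFun p = -(t • (V (φ.toFun q) - V (φ.toFun p))) := by
        have : φ.toFun p + t • V (φ.toFun p) = φ.toFun q + t • V (φ.toFun q) := hpq
        rw [smul_sub, neg_sub, sub_eq_sub_iff_add_eq_add, ← this, add_comm]
      have h3 : ‖φ.toFun q - φ.toFun p‖ ≤ |t| * K * ‖φ.toFun q - φ.toFun p‖ := by
        calc ‖φ.toFun q - φ.toFun p‖ = |t| * ‖V (φ.toFun q) - V (φ.toFun p)‖ := by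
              conv_lhs => rw [h2]
              rw [norm_neg, norm_smul, Real.norm_eq_abs]
          _ ≤ |t| * (K * ‖φ.toFun q - φ.toFun p‖) := by gcongr
          _ = _ := by ring
      have h4 : ‖φ.toFun q - φ.toFun p‖ = 0 := by
        nlinarith [norm_nonneg (φ.toFun q - φ.toFun p)]
      exact (sub_eq_zero.1 (norm_eq_zero.1 h4)).symm
    · intro p
      have hd : HasFDerivAt (fun x : Ambient n => x + t • V x)
          (ContinuousLinearMap.id ℝ (Ambient n) + t • fderiv ℝ V (φ.toFun p)) (φ.toFun p) :=
        (hasFDerivAt_id _).add ((hVd _).hasFDerivAt.const_smul t)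
      have hm : mfderiv I 𝓘(ℝ, Ambient n) (fun p => φ.toFun p + t • V (φ.toFun p)) p =
          (ContinuousLinearMap.id ℝ (Ambient n) + t • fderiv ℝ V (φ.toFun p)).comp
            (mfderiv I 𝓘(ℝ, Ambient n) φ.toFun p) :=
        (hd.hasMFDerivAt.comp p
          (φ.isEmb.contMDiff.mdifferentiableAt (by simp)).hasMFDerivAt).mfderiv
      rw [hm]
      suffices hinj : Function.Injective
          (ContinuousLinearMap.id ℝ (Ambient n) + t • fderiv ℝ V (φ.toFun p)) from
        fun v w hvw => φ.isEmb.mfderiv_injective p (hinj hvw)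
      refine (injective_iff_map_eq_zero
        (ContinuousLinearMap.id ℝ (Ambient n) + t • fderiv ℝ V (φ.toFun p))).2 fun v hv => ?_
      have h2 : v = -(t • fderiv ℝ V (φ.toFun p) v) := eq_neg_of_add_eq_zero_left (by simpa using hv)
      have h3 : ‖v‖ ≤ |t| * K * ‖v‖ := by
        calc ‖v‖ = |t| * ‖fderiv ℝ V (φ.toFun p) v‖ := by
              conv_lhs => rw [h2]
              rw [norm_neg, norm_smul, Real.norm_eq_abs]
          _ ≤ |t| * (K * ‖v‖) := by
              gcongr
              exact (fderiv ℝ V (φ.toFun p)).le_of_opNorm_le (hK _ (mem p)) v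
          _ = _ := by ring
      have h4 : ‖v‖ = 0 := by nlinarith [norm_nonneg v]
      exact norm_eq_zero.1 h4
  intro p
  rw [perturb, dif_pos key]

/-- Two pre-shapes are equivalent if they differ by a reparameterization in `Diff(M)`. -/
instance setoid [IsManifold I ∞ M] : Setoid (Emb I M) where
  r φ ψ := ∃ ρ : M ≃ₘ^∞⟮I, I⟯ M, φ.toFun = ψ.toFun ∘ ρ
  iseqv :=
    { refl := fun φ => ⟨Diffeomorph.refl I M ∞, rfl⟩
      symm := by
        rintro φ ψ ⟨ρ, h⟩
        refine ⟨ρ.symm, ?_⟩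
        funext p
        simp [h]
      trans := by
        rintro φ ψ χ ⟨ρ, h⟩ ⟨σ, h'⟩
        refine ⟨ρ.trans σ, ?_⟩
        funext p
        simp [h, h'] }

theorem perturb_equiv [IsManifold I ∞ M] (V : Ambient n → Ambient n) (t : ℝ) (φ ψ : Emb I M)
    (h : φ ≈ ψ) : φ.perturb V t ≈ ψ.perturb V t := by
  obtain ⟨ρ, hρ⟩ := h
  have e : (fun p => φ.toFun p + t • V (φ.toFun p)) =
      (fun p => ψ.toFun p + t • V (ψ.toFun p)) ∘ ρ := by
    funext p
    simp [hρ]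
  refine ⟨ρ, ?_⟩
  by_cases hψ : IsEmb I (fun p => ψ.toFun p + t • V (ψ.toFun p))
  · have hφ : IsEmb I (fun p => φ.toFun p + t • V (φ.toFun p)) := by
      rw [e]
      exact hψ.comp_diffeomorph ρ
    rw [perturb, perturb, dif_pos hψ, dif_pos hφ]
    exact e
  · have hφ : ¬ IsEmb I (fun p => φ.toFun p + t • V (φ.toFun p)) := by
      rw [e, isEmb_comp_diffeomorph_iff]
      exact hψ
    rw [perturb, perturb, dif_neg hψ, dif_neg hφ]
    exact hρ

end Emb

variable (I M) in
/-- The shape space `B_e(M, ℝⁿ⁺¹) = Emb(M, ℝⁿ⁺¹) / Diff(M)` of unparameterized shapes. -/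
def Shape [IsManifold I ∞ M] : Type _ := Quotient (Emb.setoid (I := I) (M := M))

namespace Shape

variable [IsManifold I ∞ M]

/-- The bundle projection `π : Emb(M, ℝⁿ⁺¹) → B_e(M, ℝⁿ⁺¹)`. -/
def mk (φ : Emb I M) : Shape I M := Quotient.mk _ φ

/-- The perturbation of identity `Γ_t = {x + t V(x) : x ∈ Γ}` of a shape
(see `eventually_carrier_perturb`). -/
def perturb (Γ : Shape I M) (V : Ambient n → Ambient n) (t : ℝ) : Shape I M :=
  Quotient.map (fun φ : Emb I M => φ.perturb V t) (Emb.perturb_equiv V t) Γ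

/-- The subset `φ(M)` of the ambient space that belongs to the shape `π(φ)`. -/
def carrier (Γ : Shape I M) : Set (Ambient n) :=
  Quotient.lift (fun φ : Emb I M => range φ.toFun) (by
    rintro φ ψ ⟨ρ, h⟩
    rw [h, Function.Surjective.range_comp (f := ρ) ρ.surjective]) Γ

theorem eventually_carrier_perturb [CompactSpace M] (Γ : Shape I M)
    {V : Ambient n → Ambient n} (hV : ContDiff ℝ ∞ V) :
    ∀ᶠ t in 𝓝 (0 : ℝ), (Γ.perturb V t).carrier = displace V t '' Γ.carrier := by
  induction Γ using Quotient.inductionOn with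
  | h φ =>
    filter_upwards [φ.eventually_perturb_apply hV] with t ht
    change range (φ.perturb V t).toFun = displace V t '' range φ.toFun
    rw [← range_comp]
    exact congrArg range (funext ht)

end Shape

end Manifolds

/-! ### Derivatives along perturbations

Below, `σ t` is the perturbed pre-shape `φ_t` (respectively the perturbed shape `Γ_t`), and
`f : S → ℝⁿ⁺¹ → ℝ` is a family `f_φ` of functions indexed by pre-shapes, `S = Emb(M, ℝⁿ⁺¹)`
(respectively by shapes, `S = B_e`). All derivatives are one-sided, `t ↓ 0`. -/

section Derivatives

variable {n : ℕ} {S : Type*}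

/-- The (pre-)shape derivative `𝔇f(φ)[V](x) = d/dt f_{φ_t}(x)` at `t = 0`, for fixed `x`. -/
def shapeDeriv (f : S → Ambient n → ℝ) (σ : ℝ → S) (x : Ambient n) : ℝ :=
  derivWithin (fun t => f (σ t) x) (Ici 0) 0

/-- The (pre-)shape material derivative `𝔇_m f(φ)[V](x)` exists and equals `d`:
it is the derivative of `f_{φ_t}(x_t)` at `t = 0`, where `x_t = x + t V(x)`. -/
def HasMaterialDeriv (f : S → Ambient n → ℝ) (σ : ℝ → S) (V : Ambient n → Ambient n)
    (x : Ambient n) (d : ℝ) : Prop :=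
  HasDerivWithinAt (fun t => f (σ t) (displace V t x)) d (Ici 0) 0

/-- The value of the (pre-)shape material derivative `𝔇_m f(φ)[V](x)`. -/
def materialDeriv (f : S → Ambient n → ℝ) (σ : ℝ → S) (V : Ambient n → Ambient n)
    (x : Ambient n) : ℝ :=
  derivWithin (fun t => f (σ t) (displace V t x)) (Ici 0) 0

/-- `D` is linear and bounded on the Fréchet space `C^∞(ℝⁿ⁺¹, ℝⁿ⁺¹)`, i.e. it is bounded by a
multiple of a seminorm `max_{i ≤ k} sup_{|x| ≤ R} ‖D^i V(x)‖`. -/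
def IsLinearBounded (D : (Ambient n → Ambient n) → ℝ) : Prop :=
  (∀ V W : Ambient n → Ambient n, ContDiff ℝ ∞ V → ContDiff ℝ ∞ W →
    ∀ a b : ℝ, D (a • V + b • W) = a * D V + b * D W) ∧
  ∃ (R C : ℝ) (k : ℕ), ∀ V : Ambient n → Ambient n, ContDiff ℝ ∞ V → ∀ B : ℝ,
    (∀ i ≤ k, ∀ x ∈ Metric.closedBall (0 : Ambient n) R, ‖iteratedFDeriv ℝ i V x‖ ≤ B) →
    |D V| ≤ C * B

/-- A family `f : S → ℝⁿ⁺¹ → ℝ` is (pre-)shape differentiable at the (pre-)shape `s`, whose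
perturbations in direction `V` are `σ V t`: for every smooth `V` the difference quotients
`(f_{s_t} - f_s) / t` converge for `t ↓ 0`, locally uniformly on `ℝⁿ⁺¹`, and the limit
`𝔇f(s)[V]` is linear and bounded in `V`. -/
def ShapeDifferentiable (f : S → Ambient n → ℝ) (s : S)
    (σ : (Ambient n → Ambient n) → ℝ → S) : Prop :=
  (∀ V : Ambient n → Ambient n, ContDiff ℝ ∞ V →
    TendstoLocallyUniformly (fun (t : ℝ) x => (f (σ V t) x - f s x) / t)
      (fun x => shapeDeriv f (σ V) x) (𝓝[>] 0)) ∧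
  ∀ x, IsLinearBounded fun V => shapeDeriv f (σ V) x

end Derivatives

/-! ### Domains, hypersurfaces and divergence -/

section Geometry

variable {n : ℕ}

/-- `Ω` is open and bounded with Lipschitz boundary: near each boundary point there are a unit
vector `ν` and a Lipschitz function `γ` of the component orthogonal to `ν` such that `Ω` is the
set of the points above the graph of `γ` in direction `ν`. -/
structure IsLipschitzDomain (Ω : Set (Ambient n)) : Prop where
  isOpen : IsOpen Ω
  isBounded : Bornology.IsBounded Ω
  boundary : ∀ p ∈ frontier Ω, ∃ U : Set (Ambient n), IsOpen U ∧ p ∈ U ∧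
    ∃ ν : Ambient n, ‖ν‖ = 1 ∧ ∃ γ : Ambient n → ℝ, (∃ K, LipschitzWith K γ) ∧
      Ω ∩ U = {x ∈ U | γ (x - inner ℝ ν x • ν) < inner ℝ ν x}

/-- `Γ` is an `n`-dimensional embedded `C^∞`-submanifold of `ℝⁿ⁺¹`: around each of its points there
is a smooth chart of `ℝⁿ⁺¹` that straightens `Γ` to a piece of `ℝⁿ × {0}`. -/
def IsSmoothHypersurface (Γ : Set (Ambient n)) : Prop :=
  ∀ p ∈ Γ, ∃ Φ : OpenPartialHomeomorph (Ambient n) (EuclideanSpace ℝ (Fin n) × ℝ),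
    p ∈ Φ.source ∧ ContDiffOn ℝ ∞ Φ Φ.source ∧ ContDiffOn ℝ ∞ Φ.symm Φ.target ∧
    Γ ∩ Φ.source = {x ∈ Φ.source | (Φ x).2 = 0}

/-- The divergence of a vector field. -/
def divergence (V : Ambient n → Ambient n) (x : Ambient n) : ℝ :=
  LinearMap.trace ℝ (Ambient n) (fderiv ℝ V x).toLinearMap

/-- The tangent space of `Γ` at `x`, as a linear subspace of the ambient space. -/
def tangentSubspace (Γ : Set (Ambient n)) (x : Ambient n) : Submodule ℝ (Ambient n) :=
  Submodule.span ℝ (tangentConeAt ℝ Γ x)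

/-- The tangential divergence `div_Γ V = tr (P DV)`, where `P` is the orthogonal projection onto
the tangent space of `Γ`; that is, `div_Γ V = ∑ ⟨DV τ_i, τ_i⟩` for an orthonormal basis `τ_i` of
the tangent space. -/
def tangentialDivergence (Γ : Set (Ambient n)) (V : Ambient n → Ambient n) (x : Ambient n) : ℝ :=
  LinearMap.trace ℝ (Ambient n)
    ((tangentSubspace Γ x).starProjection.comp (fderiv ℝ V x)).toLinearMap

end Geometry

end PreShape

end

open PreShape

open Set Filter Topology MeasureTheory
open scoped Manifold ContDiff

namespace PreShape

/-! ### Elementary rules -/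

section Rules

variable {n : ℕ} {S : Type*}

/-! The calculus uses only a family indexed by an arbitrary set `S` and a curve `σ V` with `σ V 0 =
s`. Pre-shapes and shapes are then two instances, entering through `Emb.perturb_zero` and
`Shape.perturb_zero`.

For the decomposition, the increment of `t ↦ f_{φ_t}(T_t x)` splits into `(f_{φ_t} - f_φ)(T_t x)`
and `f_φ(T_t x) - f_φ(x)`. Divided by `t`, the first term converges although its base point moves,
because the quotients converge locally uniformly to a continuous limit; the second is the ordinary
chain rule. The product and composition rules are then one-variable calculus in `t`.

For the integrals, a change of variables pulls `T_t(A)` back to the fixed set `A` with a density `J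
t`, and dominated convergence is applied to `(J t · f_{φ_t} ∘ T_t - f_φ) / t`. Domination holds
because both `J t - 1` and `f_{φ_t} ∘ T_t - f_φ` are `O(t)` uniformly on `A`; the second bound is
where local Lipschitz continuity of `f_φ` enters. This common argument is
`ShapeDifferentiable.hasDerivWithinAt_setIntegral`.

On domains the density is `|det(1 + t DV)|`, with derivative `tr DV`. On a hypersurface it is the
Jacobian of `1 + t DV` restricted to the tangent space, whose square is a Gram determinant;
differentiating its root gives `tr(P DV)`. The surface change of variables rests on an area formula,
`IsSmoothHypersurface.measure_image_eq_lintegral`: near each point the map is metrically close to a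
linear map on the tangent plane, and the errors disappear after a countable decomposition and a
limit. -/

theorem hasDerivWithinAt_Ici_zero_iff {u : ℝ → ℝ} {d : ℝ} :
    HasDerivWithinAt u d (Ici 0) 0 ↔ Tendsto (fun t => (u t - u 0) / t) (𝓝[>] 0) (𝓝 d) := by
  rw [← hasDerivWithinAt_Ioi_iff_Ici, hasDerivWithinAt_iff_tendsto_slope' (by simp)]
  refine tendsto_congr fun t => ?_
  rw [slope_def_field, sub_zero]

@[simp]
theorem displace_zero (V : Ambient n → Ambient n) (x : Ambient n) : displace V 0 x = x := by
  simp [displace]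

theorem hasDerivAt_displace (V : Ambient n → Ambient n) (x : Ambient n) (t : ℝ) :
    HasDerivAt (fun t => displace V t x) (V x) t := by
  simpa [displace] using ((hasDerivAt_id t).smul_const (V x)).const_add x

theorem tendsto_displace (V : Ambient n → Ambient n) (x : Ambient n) :
    Tendsto (fun t => displace V t x) (𝓝[>] 0) (𝓝 x) := by
  simpa using (hasDerivAt_displace V x 0).continuousAt.tendsto.mono_left nhdsWithin_le_nhds

theorem continuous_displace {V : Ambient n → Ambient n} (hV : Continuous V) (t : ℝ) :
    Continuous (displace V t) :=
  continuous_id.add (hV.const_smul t)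

variable {f g : S → Ambient n → ℝ} {s : S} {σ : (Ambient n → Ambient n) → ℝ → S}
  {V : Ambient n → Ambient n}

/-- A locally uniform limit of continuous functions is continuous. This allows evaluation at moving
points and yields bounds on compact sets. -/
theorem ShapeDifferentiable.continuous_shapeDeriv (hf : ShapeDifferentiable f s σ)
    (hfd : ∀ s, Differentiable ℝ (f s)) (hV : ContDiff ℝ ∞ V) :
    Continuous fun x => shapeDeriv f (σ V) x :=
  (hf.1 V hV).continuous (Eventually.frequently (Eventually.of_forall fun t =>
    ((hfd _).continuous.sub (hfd _).continuous).div_const t))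

/-- The material derivative is the sum of the shape derivative and the directional derivative. -/
theorem ShapeDifferentiable.hasMaterialDeriv (hf : ShapeDifferentiable f s σ)
    (hfd : ∀ s, Differentiable ℝ (f s)) (hV : ContDiff ℝ ∞ V) (hσ : σ V 0 = s) (x : Ambient n) :
    HasMaterialDeriv f (σ V) V x
      (shapeDeriv f (σ V) x + inner ℝ (gradient (f s) x) (V x)) := by
  have h1 : Tendsto (fun t => (f (σ V t) (displace V t x) - f s (displace V t x)) / t)
      (𝓝[>] 0) (𝓝 (shapeDeriv f (σ V) x)) :=
    (hf.1 V hV).tendsto_comp (hf.continuous_shapeDeriv hfd hV).continuousAt (tendsto_displace V x)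
  have h2 : HasDerivAt (fun t => f s (displace V t x)) (inner ℝ (gradient (f s) x) (V x)) 0 := by
    have h3 : HasFDerivAt (f s) (fderiv ℝ (f s) x) (displace V 0 x) := by
      simpa using (hfd s x).hasFDerivAt
    rw [inner_gradient_left]
    exact h3.comp_hasDerivAt 0 (hasDerivAt_displace V x 0)
  have h3 := hasDerivWithinAt_Ici_zero_iff.1 h2.hasDerivWithinAt
  refine hasDerivWithinAt_Ici_zero_iff.2 ((h1.add h3).congr fun t => ?_)
  rw [← add_div, hσ]
  simp

theorem HasMaterialDeriv.materialDeriv {σ : ℝ → S} {x : Ambient n} {d : ℝ}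
    (h : HasMaterialDeriv f σ V x d) : materialDeriv f σ V x = d :=
  h.derivWithin (uniqueDiffWithinAt_Ici 0)

theorem HasMaterialDeriv.mul {σ : ℝ → S} {x : Ambient n} {d e : ℝ}
    (hf : HasMaterialDeriv f σ V x d) (hg : HasMaterialDeriv g σ V x e) :
    HasMaterialDeriv (fun s y => f s y * g s y) σ V x (d * g (σ 0) x + f (σ 0) x * e) := by
  simpa [HasMaterialDeriv] using HasDerivWithinAt.fun_mul hf hg

theorem HasMaterialDeriv.comp {σ : ℝ → S} {x : Ambient n} {d : ℝ} {h : ℝ → ℝ}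
    (hh : Differentiable ℝ h) (hf : HasMaterialDeriv f σ V x d) :
    HasMaterialDeriv (fun s y => h (f s y)) σ V x (deriv h (f (σ 0) x) * d) := by
  have := (hh (f (σ 0) (displace V 0 x))).hasDerivAt.comp_hasDerivWithinAt 0 hf
  simpa [HasMaterialDeriv, Function.comp_def] using this

end Rules

/-! ### Differentiation of integrals over perturbed sets -/

section Integrals

variable {n : ℕ} {S : Type*} {f : S → Ambient n → ℝ} {s : S}
  {σ : (Ambient n → Ambient n) → ℝ → S} {V : Ambient n → Ambient n}

/-- A single compact ball holds `A` and all its displacements for `0 ≤ t ≤ 1`, so compactness bounds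
apply at `x` and at `T_t x` alike. -/
theorem exists_closedBall_displace (hV : Continuous V) {A : Set (Ambient n)}
    (hA : Bornology.IsBounded A) :
    ∃ R K : ℝ, 0 ≤ K ∧ A ⊆ Metric.closedBall 0 R ∧ (∀ x ∈ A, ‖V x‖ ≤ K) ∧
      ∀ t ∈ Icc (0 : ℝ) 1, displace V t '' A ⊆ Metric.closedBall 0 R := by
  obtain ⟨r, hr⟩ := hA.subset_closedBall 0
  obtain ⟨K, hK⟩ := (isCompact_closedBall (0 : Ambient n) r).exists_bound_of_continuousOn
    hV.continuousOn
  have hK' : ∀ x ∈ A, ‖V x‖ ≤ max K 0 := fun x hx => (hK x (hr hx)).trans (le_max_left _ _)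
  refine ⟨r + max K 0, max K 0, le_max_right _ _,
    hr.trans (Metric.closedBall_subset_closedBall (by simp)), hK', ?_⟩
  rintro t ht _ ⟨x, hx, rfl⟩
  have h1 : ‖x‖ ≤ r := by simpa using hr hx
  rw [mem_closedBall_zero_iff]
  calc ‖x + t • V x‖ ≤ ‖x‖ + ‖t • V x‖ := norm_add_le _ _
    _ = ‖x‖ + t * ‖V x‖ := by rw [norm_smul, Real.norm_of_nonneg ht.1]
    _ ≤ r + 1 * max K 0 := by
      gcongr
      · exact ht.2
      · exact hK' x hx
    _ = _ := by ring

theorem Icc_zero_one_mem_nhdsGE : Icc (0 : ℝ) 1 ∈ 𝓝[≥] (0 : ℝ) :=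
  Icc_mem_nhdsGE (by norm_num)

/-- On bounded sets the increments along the perturbation are of order `t`. -/
theorem ShapeDifferentiable.exists_bound (hf : ShapeDifferentiable f s σ)
    (hfd : ∀ s, Differentiable ℝ (f s)) (hV : ContDiff ℝ ∞ V) (hσ : σ V 0 = s)
    (hL : LocallyLipschitz (f s)) {A : Set (Ambient n)} (hA : Bornology.IsBounded A) :
    ∃ C, ∀ᶠ t in 𝓝[≥] (0 : ℝ), ∀ x ∈ A, |f (σ V t) (displace V t x) - f s x| ≤ C * t := by
  obtain ⟨R, K, hK0, hAR, hK, hR⟩ := exists_closedBall_displace hV.continuous hA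
  have hc := isCompact_closedBall (0 : Ambient n) R
  obtain ⟨L, hL'⟩ := LocallyLipschitzOn.exists_lipschitzOnWith_of_compact hc
    hL.locallyLipschitzOn
  obtain ⟨D, hD⟩ := hc.exists_bound_of_continuousOn
    (hf.continuous_shapeDeriv hfd hV).continuousOn
  have h1 := tendstoLocallyUniformly_iff_forall_isCompact.1 (hf.1 V hV) _ hc
  rw [Metric.tendstoUniformlyOn_iff] at h1
  have h2 := h1 1 one_pos
  rw [eventually_nhdsWithin_iff] at h2
  -- `D` bounds the shape derivative on the ball and `1` is the uniform error of the quotients; `L *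
  -- K` is the Lipschitz constant times the bound for `V` on `A`.
  refine ⟨D + 1 + L * K, ?_⟩
  filter_upwards [nhdsWithin_le_nhds h2, Icc_zero_one_mem_nhdsGE] with t ht ht1 x hx
  -- The quotients are controlled only for `t > 0`; at `t = 0` the increment vanishes by `hσ`.
  rcases ht1.1.eq_or_lt with rfl | htpos
  · simp [hσ]
  have hy : displace V t x ∈ Metric.closedBall (0 : Ambient n) R := hR t ht1 ⟨x, hx, rfl⟩
  have h3 : |f (σ V t) (displace V t x) - f s (displace V t x)| ≤ (D + 1) * t := by
    have h4 := ht htpos _ hy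
    have h5 := hD _ hy
    rw [dist_comm, Real.dist_eq] at h4
    rw [Real.norm_eq_abs] at h5
    have h6 : |(f (σ V t) (displace V t x) - f s (displace V t x)) / t| ≤ D + 1 := by
      have := abs_sub_abs_le_abs_sub
        ((f (σ V t) (displace V t x) - f s (displace V t x)) / t)
        (shapeDeriv f (σ V) (displace V t x))
      linarith
    rwa [abs_div, abs_of_pos htpos, div_le_iff₀ htpos] at h6
  have h4 : |f s (displace V t x) - f s x| ≤ L * K * t := by
    have h5 := hL'.dist_le_mul _ hy _ (hAR hx)
    rw [Real.dist_eq, dist_eq_norm] at h5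
    refine h5.trans ?_
    have : displace V t x - x = t • V x := by simp [displace]
    rw [this, norm_smul, Real.norm_of_nonneg htpos.le, mul_assoc, mul_comm K]
    gcongr
    exact hK x hx
  calc |f (σ V t) (displace V t x) - f s x|
      ≤ |f (σ V t) (displace V t x) - f s (displace V t x)| + |f s (displace V t x) - f s x| :=
        abs_sub_le _ _ _
    _ ≤ _ := by linarith

/-- Differentiation of `∫_{T_t(A)} f_{φ_t} dμ`, given a change of variables formula for the
integrals over `T_t(A)` with densities `J t` whose derivative at `t = 0` is `d`. -/
theorem ShapeDifferentiable.hasDerivWithinAt_setIntegral (hf : ShapeDifferentiable f s σ)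
    (hfd : ∀ s, Differentiable ℝ (f s)) (hV : ContDiff ℝ ∞ V) (hσ : σ V 0 = s)
    (hL : LocallyLipschitz (f s)) {μ : Measure (Ambient n)} {A : Set (Ambient n)}
    (hA : Bornology.IsBounded A) (hAm : MeasurableSet A) (hμA : μ A < ⊤)
    {J : ℝ → Ambient n → ℝ} {d : Ambient n → ℝ}
    (hJm : ∀ᶠ t in 𝓝[≥] (0 : ℝ), AEStronglyMeasurable (J t) (μ.restrict A))
    (hJd : ∀ x ∈ A, HasDerivWithinAt (fun t => J t x) (d x) (Ici 0) 0)
    (hJ0 : ∀ x ∈ A, J 0 x = 1)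
    (hJb : ∃ C, ∀ᶠ t in 𝓝[≥] (0 : ℝ), ∀ x ∈ A, |J t x - 1| ≤ C * t)
    (hTm : ∀ᶠ t in 𝓝[≥] (0 : ℝ), MeasurableSet (displace V t '' A))
    (hTf : ∀ᶠ t in 𝓝[≥] (0 : ℝ), μ (displace V t '' A) < ⊤)
    (hTJ : ∀ᶠ t in 𝓝[≥] (0 : ℝ), ∀ u : Ambient n → ℝ, Continuous u →
      ∫ y in displace V t '' A, u y ∂μ = ∫ x in A, J t x * u (displace V t x) ∂μ) :
    (∀ᶠ t in 𝓝[≥] (0 : ℝ), IntegrableOn (f (σ V t)) (displace V t '' A) μ) ∧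
    IntegrableOn (fun x => materialDeriv f (σ V) V x + d x * f s x) A μ ∧
    HasDerivWithinAt (fun t => ∫ y in displace V t '' A, f (σ V t) y ∂μ)
      (∫ x in A, (materialDeriv f (σ V) V x + d x * f s x) ∂μ) (Ici 0) 0 := by
  obtain ⟨R, K, hK0, hAR, hK, hR⟩ := exists_closedBall_displace hV.continuous hA
  have hc := isCompact_closedBall (0 : Ambient n) R
  have hfc : ∀ s, Continuous (f s) := fun s => (hfd s).continuous
  have : Fact (μ A < ⊤) := ⟨hμA⟩
  obtain ⟨Cf, hCf⟩ := hf.exists_bound hfd hV hσ hL hA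
  obtain ⟨CJ, hCJ⟩ := hJb
  obtain ⟨B, hB⟩ := hc.exists_bound_of_continuousOn (hfc s).continuousOn
  have hint : ∀ᶠ t in 𝓝[≥] (0 : ℝ), IntegrableOn (f (σ V t)) (displace V t '' A) μ := by
    filter_upwards [hTm, hTf, Icc_zero_one_mem_nhdsGE] with t htm htf ht1
    obtain ⟨b, hb⟩ := hc.exists_bound_of_continuousOn (hfc (σ V t)).continuousOn
    exact Measure.integrableOn_of_bounded (M := b) htf.ne (hfc _).aestronglyMeasurable
      (ae_restrict_of_forall_mem htm fun y hy => hb y (hR t ht1 hy))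
  set q : ℝ → Ambient n → ℝ := fun t x => (J t x * f (σ V t) (displace V t x) - f s x) / t with hq
  have hlim : ∀ x ∈ A, Tendsto (fun t => q t x) (𝓝[>] 0)
      (𝓝 (materialDeriv f (σ V) V x + d x * f s x)) := by
    intro x hx
    have hm := hf.hasMaterialDeriv hfd hV hσ x
    rw [← hm.materialDeriv] at hm
    have := hasDerivWithinAt_Ici_zero_iff.1 ((hJd x hx).fun_mul hm)
    simpa [hJ0 x hx, hσ, add_comm, hq] using this
  have hmeas : ∀ᶠ t in 𝓝[>] (0 : ℝ), AEStronglyMeasurable (q t) (μ.restrict A) := by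
    filter_upwards [hJm.filter_mono (nhdsWithin_mono _ Ioi_subset_Ici_self)] with t ht
    have h1 : AEStronglyMeasurable (fun x => f (σ V t) (displace V t x)) (μ.restrict A) :=
      ((hfc _).comp (continuous_displace hV.continuous t)).aestronglyMeasurable
    have h2 : AEStronglyMeasurable (f s) (μ.restrict A) := (hfc _).aestronglyMeasurable
    simpa [hq, div_eq_mul_inv] using ((ht.mul h1).sub h2).mul_const t⁻¹
  -- The constant comes from `J f_t - f = J (f_t - f) + (J - 1) f`, where `|J| ≤ |CJ| + 1` for `t ≤
  -- 1`.
  have hbound : ∀ᶠ t in 𝓝[>] (0 : ℝ), ∀ x ∈ A, ‖q t x‖ ≤ (|CJ| + 1) * |Cf| + |CJ| * |B| := by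
    filter_upwards [hCf.filter_mono (nhdsWithin_mono _ Ioi_subset_Ici_self),
      hCJ.filter_mono (nhdsWithin_mono _ Ioi_subset_Ici_self),
      nhdsWithin_mono _ Ioi_subset_Ici_self Icc_zero_one_mem_nhdsGE,
      self_mem_nhdsWithin] with t h1 h2 ht1 htpos x hx
    replace htpos : 0 < t := htpos
    have h3 : |f (σ V t) (displace V t x) - f s x| ≤ |Cf| * t :=
      (h1 x hx).trans (by gcongr; exact le_abs_self _)
    have h4 : |J t x - 1| ≤ |CJ| * t := (h2 x hx).trans (by gcongr; exact le_abs_self _)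
    have h5 : |f s x| ≤ |B| := (hB x (hAR hx)).trans (le_abs_self _)
    have h6 : |J t x| ≤ |CJ| + 1 := by
      have h7 := abs_sub_abs_le_abs_sub (J t x) 1
      have h8 : |CJ| * t ≤ |CJ| * 1 := by gcongr; exact ht1.2
      rw [abs_one] at h7
      linarith
    rw [Real.norm_eq_abs, abs_div, abs_of_pos htpos, div_le_iff₀ htpos]
    have h7 : J t x * f (σ V t) (displace V t x) - f s x =
        J t x * (f (σ V t) (displace V t x) - f s x) + (J t x - 1) * f s x := by ring
    calc |J t x * f (σ V t) (displace V t x) - f s x|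
        ≤ |J t x| * |f (σ V t) (displace V t x) - f s x| + |J t x - 1| * |f s x| := by
          rw [h7, ← abs_mul, ← abs_mul]
          exact abs_add_le _ _
      _ ≤ (|CJ| + 1) * (|Cf| * t) + (|CJ| * t) * |B| := by gcongr
      _ = _ := by ring
  have hlim' : ∀ᵐ x ∂μ.restrict A, Tendsto (fun t => q t x) (𝓝[>] 0)
      (𝓝 (materialDeriv f (σ V) V x + d x * f s x)) := ae_restrict_of_forall_mem hAm hlim
  refine ⟨hint, ?_, ?_⟩
  -- The limit integrand is measurable as a pointwise limit along a sequence `u k ↓ 0`; the shift by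
  -- `N` discards the terms where `q` is not yet known to be measurable. Its bound is inherited from
  -- the quotients.
  · obtain ⟨u, hu⟩ := exists_seq_tendsto (𝓝[>] (0 : ℝ))
    obtain ⟨N, hN⟩ := eventually_atTop.1 (hu.eventually hmeas)
    have hm : AEStronglyMeasurable (fun x => materialDeriv f (σ V) V x + d x * f s x)
        (μ.restrict A) := by
      refine aestronglyMeasurable_of_tendsto_ae atTop (f := fun k => q (u (k + N)))
        (fun k => hN _ (by omega)) ?_
      filter_upwards [hlim'] with x hx
      exact hx.comp (hu.comp (tendsto_add_atTop_nat N))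
    refine Integrable.of_bound hm ((|CJ| + 1) * |Cf| + |CJ| * |B|)
      (ae_restrict_of_forall_mem hAm fun x hx => ?_)
    refine le_of_tendsto (hlim x hx).norm ?_
    filter_upwards [hbound] with t ht using ht x hx
  · rw [hasDerivWithinAt_Ici_zero_iff]
    refine Tendsto.congr' ?_ (tendsto_integral_filter_of_dominated_convergence (F := q)
      (fun _ => (|CJ| + 1) * |Cf| + |CJ| * |B|) hmeas ?_ (integrable_const _) hlim')
    · have hsub : 𝓝[>] (0 : ℝ) ≤ 𝓝[≥] 0 := nhdsWithin_mono _ Ioi_subset_Ici_self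
      filter_upwards [hTJ.filter_mono hsub, hJm.filter_mono hsub,
        nhdsWithin_mono _ Ioi_subset_Ici_self Icc_zero_one_mem_nhdsGE,
        hCJ.filter_mono hsub] with t h1 h2 ht1 h3
      have h4 : IntegrableOn (f s) A μ :=
        Measure.integrableOn_of_bounded hμA.ne (hfc s).aestronglyMeasurable
          (ae_restrict_of_forall_mem hAm fun x hx => hB x (hAR hx))
      have h5 : IntegrableOn (fun x => J t x * f (σ V t) (displace V t x)) A μ := by
        obtain ⟨b, hb⟩ := hc.exists_bound_of_continuousOn (hfc (σ V t)).continuousOn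
        refine Integrable.of_bound (h2.mul
          ((hfc (σ V t)).comp (continuous_displace hV.continuous t)).aestronglyMeasurable)
          ((|CJ| + 1) * |b|) (ae_restrict_of_forall_mem hAm fun x hx => ?_)
        rw [norm_mul]
        gcongr
        · have h7 := abs_sub_abs_le_abs_sub (J t x) 1
          have h8 : |J t x - 1| ≤ |CJ| * t :=
            (h3 x hx).trans (mul_le_mul_of_nonneg_right (le_abs_self _) ht1.1)
          have h9 : |CJ| * t ≤ |CJ| * 1 := by gcongr; exact ht1.2
          rw [abs_one] at h7
          rw [Real.norm_eq_abs]
          linarith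
        · exact (hb _ (hR t ht1 ⟨x, hx, rfl⟩)).trans (le_abs_self _)
      have h6 : displace V 0 '' A = A := by
        rw [show displace V 0 = id from funext fun x => displace_zero V x, image_id]
      simp only [hq]
      rw [integral_div, integral_sub h5 h4, h1 _ (hfc _), h6, hσ]
    · filter_upwards [hbound] with t ht using ae_restrict_of_forall_mem hAm ht

end Integrals

end PreShape

/-! ### Determinants and Jacobians of linear maps -/

section Determinant

open Module

variable {E : Type*} [NormedAddCommGroup E] [InnerProductSpace ℝ E] [FiniteDimensional ℝ E]

/-- In a basis the determinant is a polynomial in entries that depend linearly on the map. -/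
theorem ContinuousLinearMap.differentiable_det :
    Differentiable ℝ fun A : E →L[ℝ] E => A.det := by
  let b := finBasis ℝ E
  have h : ∀ A : E →L[ℝ] E, A.det = (LinearMap.toMatrix b b A.toLinearMap).det := fun A =>
    (LinearMap.det_toMatrix b _).symm
  simp_rw [h, Matrix.det_apply]
  have h2 : ∀ i j, Differentiable ℝ fun A : E →L[ℝ] E =>
      LinearMap.toMatrix b b A.toLinearMap i j := by
    intro i j
    let L : (E →L[ℝ] E) →ₗ[ℝ] ℝ :=
      { toFun := fun A => LinearMap.toMatrix b b A.toLinearMap i j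
        map_add' := fun A B => by simp
        map_smul' := fun c A => by simp }
    exact (LinearMap.toContinuousLinearMap L).differentiable
  refine Differentiable.fun_sum fun σ _ => Differentiable.fun_const_smul ?_ _
  exact fun A => (HasFDerivAt.finsetProd fun i _ => (h2 (σ i) i A).hasFDerivAt).differentiableAt

/-- The trace of a continuous linear endomorphism, as a continuous linear functional. -/
noncomputable def ContinuousLinearMap.traceCLM : (E →L[ℝ] E) →L[ℝ] ℝ :=
  LinearMap.toContinuousLinearMap
    (LinearMap.trace ℝ E ∘ₗ (LinearMap.toContinuousLinearMap (𝕜 := ℝ) (E := E) (F' := E)).symm.toLinearMap)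

theorem ContinuousLinearMap.traceCLM_apply (A : E →L[ℝ] E) :
    ContinuousLinearMap.traceCLM A = LinearMap.trace ℝ E A.toLinearMap := rfl

/-- The expansion `det(1 + t A) = 1 + t tr A + t² p(t)`, with `p` a polynomial, leaves only the
trace at first order. -/
theorem ContinuousLinearMap.hasDerivAt_det_one_add_smul (A : E →L[ℝ] E) :
    HasDerivAt (fun t : ℝ => (1 + t • A).det) (ContinuousLinearMap.traceCLM A) 0 := by
  let b := finBasis ℝ E
  have h : ∀ t : ℝ, (1 + t • A).det =
      (1 + t • LinearMap.toMatrix b b A.toLinearMap).det := by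
    intro t
    rw [ContinuousLinearMap.det, ← LinearMap.det_toMatrix b]
    congr 1
    rw [← LinearMap.toMatrix_one b, ← map_smul, ← map_add]
    rfl
  rw [funext h, funext fun t => Matrix.det_one_add_smul t (LinearMap.toMatrix b b A.toLinearMap)]
  rw [ContinuousLinearMap.traceCLM_apply, LinearMap.trace_eq_matrix_trace ℝ b]
  set p := (Matrix.det (1 + (Polynomial.X : Polynomial ℝ) •
    (LinearMap.toMatrix b b A.toLinearMap).map Polynomial.C)).divX.divX
  have h1 := ((hasDerivAt_id (0 : ℝ)).const_mul
    (LinearMap.toMatrix b b A.toLinearMap).trace).const_add 1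
  have h2 := (p.hasDerivAt (0 : ℝ)).mul ((hasDerivAt_id (0 : ℝ)).pow 2)
  have h3 := h1.add h2
  simp at h3
  exact h3

/-- Differentiability being known, the derivative is determined by its values along the lines `1 + t
A`. -/
theorem ContinuousLinearMap.hasFDerivAt_det_one :
    HasFDerivAt (fun A : E →L[ℝ] E => A.det) ContinuousLinearMap.traceCLM 1 := by
  have h := (ContinuousLinearMap.differentiable_det (E := E) 1).hasFDerivAt
  convert! h
  ext A
  have h1 : HasDerivAt (fun t : ℝ => (1 : E →L[ℝ] E) + t • A) A 0 := by
    simpa using ((hasDerivAt_id (0 : ℝ)).smul_const A).const_add 1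
  have h2 : HasFDerivAt (fun A : E →L[ℝ] E => A.det) (fderiv ℝ (fun A : E →L[ℝ] E => A.det) 1)
      ((1 : E →L[ℝ] E) + (0 : ℝ) • A) := by simpa using h
  have h3 := h2.comp_hasDerivAt 0 h1
  exact (ContinuousLinearMap.hasDerivAt_det_one_add_smul A).unique h3

theorem ContinuousLinearMap.exists_abs_det_one_add_sub_one_le :
    ∃ C δ : ℝ, 0 < C ∧ 0 < δ ∧ ∀ Z : E →L[ℝ] E, ‖Z‖ < δ → |(1 + Z).det - 1| ≤ C * ‖Z‖ := by
  have h := (ContinuousLinearMap.hasFDerivAt_det_one (E := E)).isBigO_sub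
  obtain ⟨C, hC, h⟩ := h.exists_pos
  rw [Asymptotics.IsBigOWith, Metric.eventually_nhds_iff] at h
  obtain ⟨δ, hδ, h⟩ := h
  refine ⟨C, δ, hC, hδ, fun Z hZ => ?_⟩
  have := h (y := 1 + Z) (by simpa using hZ)
  simpa [ContinuousLinearMap.det] using this

/-- This Sylvester identity trades a determinant on a subspace for one on the fixed ambient space.
-/
theorem LinearMap.det_one_add_comp_comm {U : Type*} [AddCommGroup U] [Module ℝ U]
    [FiniteDimensional ℝ U] (f : U →ₗ[ℝ] E) (g : E →ₗ[ℝ] U) :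
    LinearMap.det (1 + f ∘ₗ g) = LinearMap.det (1 + g ∘ₗ f) := by
  let b := finBasis ℝ E
  let c := finBasis ℝ U
  rw [← LinearMap.det_toMatrix b, ← LinearMap.det_toMatrix c, map_add, map_add,
    LinearMap.toMatrix_comp b c b, LinearMap.toMatrix_comp c b c, LinearMap.toMatrix_one,
    LinearMap.toMatrix_one, Matrix.det_one_add_mul_comm]

/-- The factor by which a linear map scales the surface measure of a subspace. -/
noncomputable def ContinuousLinearMap.subspaceJacobian (A : E →L[ℝ] E) (P : Submodule ℝ E) : ℝ :=
  (A.toLinearMap ∘ₗ P.subtype).normDet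

theorem ContinuousLinearMap.subspaceJacobian_nonneg (A : E →L[ℝ] E) (P : Submodule ℝ E) :
    0 ≤ A.subspaceJacobian P :=
  LinearMap.normDet_nonneg _

/-- The squared Jacobian is the Gram determinant of `A` restricted to `P`. Writing it as `1` plus a
map through `P` lets the Sylvester identity move it to all of `E`, where the dependence on `P` is
only through its projection. Continuity in `P` and bounds uniform in `P` become accessible this way.
-/
theorem ContinuousLinearMap.subspaceJacobian_sq (A : E →L[ℝ] E) (P : Submodule ℝ E) :
    A.subspaceJacobian P ^ 2 =
      (1 + (A.adjoint.comp A - 1).comp P.starProjection).det := by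
  have h1 := (A.comp P.subtypeL).normDet_sq
  have h2 : ((A.comp P.subtypeL).adjoint.comp (A.comp P.subtypeL)).toLinearMap =
      1 + P.orthogonalProjectionOnto.toLinearMap ∘ₗ
        ((A.adjoint.comp A - 1).toLinearMap ∘ₗ P.subtype) := by
    rw [ContinuousLinearMap.adjoint_comp, Submodule.adjoint_subtypeL]
    ext v
    simp
  rw [ContinuousLinearMap.det, h2, ← LinearMap.det_one_add_comp_comm] at h1
  exact h1

theorem ContinuousLinearMap.subspaceJacobian_eq_sqrt (A : E →L[ℝ] E) (P : Submodule ℝ E) :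
    A.subspaceJacobian P =
      √(1 + (A.adjoint.comp A - 1).comp P.starProjection).det := by
  rw [← A.subspaceJacobian_sq, Real.sqrt_sq (A.subspaceJacobian_nonneg P)]

theorem ContinuousLinearMap.adjoint_comp_self_one_add_smul (B : E →L[ℝ] E) (t : ℝ) :
    (1 + t • B).adjoint.comp (1 + t • B) - 1 =
      t • (B + B.adjoint) + t ^ 2 • B.adjoint.comp B := by
  ext v
  simp [ContinuousLinearMap.one_def, ContinuousLinearMap.adjoint_id]
  module

theorem ContinuousLinearMap.traceCLM_comp_comm (A B : E →L[ℝ] E) :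
    ContinuousLinearMap.traceCLM (A.comp B) = ContinuousLinearMap.traceCLM (B.comp A) :=
  LinearMap.trace_mul_comm ℝ A.toLinearMap B.toLinearMap

theorem ContinuousLinearMap.traceCLM_adjoint (A : E →L[ℝ] E) :
    ContinuousLinearMap.traceCLM A.adjoint = ContinuousLinearMap.traceCLM A := by
  let b := stdOrthonormalBasis ℝ E
  rw [ContinuousLinearMap.traceCLM_apply, ContinuousLinearMap.traceCLM_apply,
    LinearMap.trace_eq_sum_inner _ b, LinearMap.trace_eq_sum_inner _ b]
  refine Finset.sum_congr rfl fun i _ => ?_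
  rw [ContinuousLinearMap.coe_coe, ContinuousLinearMap.coe_coe,
    ContinuousLinearMap.adjoint_inner_right, real_inner_comm]

/-- To first order the Gram determinant is `1 + t tr((B + B*) P)`. Since `P` is self-adjoint, both
summands have trace `tr(P B)`, and the square root halves the total. -/
theorem ContinuousLinearMap.hasDerivAt_subspaceJacobian_one_add_smul (B : E →L[ℝ] E)
    (P : Submodule ℝ E) :
    HasDerivAt (fun t : ℝ => (1 + t • B).subspaceJacobian P)
      (LinearMap.trace ℝ E (P.starProjection.comp B).toLinearMap) 0 := by
  simp_rw [ContinuousLinearMap.subspaceJacobian_eq_sqrt,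
    ContinuousLinearMap.adjoint_comp_self_one_add_smul]
  have h1 : HasDerivAt (fun t : ℝ => 1 + (t • (B + B.adjoint) +
      t ^ 2 • B.adjoint.comp B).comp P.starProjection)
      ((B + B.adjoint).comp P.starProjection) 0 := by
    have h2 : HasDerivAt (fun t : ℝ => 1 + (t • (B + B.adjoint).comp P.starProjection +
        t ^ 2 • (B.adjoint.comp B).comp P.starProjection))
        ((1 : ℝ) • (B + B.adjoint).comp P.starProjection +
          ((2 : ℕ) * (0 : ℝ) ^ (2 - 1) * 1) • (B.adjoint.comp B).comp P.starProjection) 0 :=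
      (((hasDerivAt_id (0 : ℝ)).smul_const _).add
        (((hasDerivAt_id (0 : ℝ)).pow 2).smul_const _)).const_add 1
    simpa [ContinuousLinearMap.add_comp, ContinuousLinearMap.smul_comp] using h2
  have h3 : HasFDerivAt (fun A : E →L[ℝ] E => A.det) ContinuousLinearMap.traceCLM
      (1 + ((0 : ℝ) • (B + B.adjoint) +
        (0 : ℝ) ^ 2 • B.adjoint.comp B).comp P.starProjection) := by
    simpa using ContinuousLinearMap.hasFDerivAt_det_one (E := E)
  have h4 := (h3.comp_hasDerivAt 0 h1).sqrt (by simp [ContinuousLinearMap.det])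
  convert! h4 using 1
  have h5 : ContinuousLinearMap.traceCLM (B.adjoint.comp P.starProjection) =
      ContinuousLinearMap.traceCLM (B.comp P.starProjection) := by
    rw [← ContinuousLinearMap.traceCLM_adjoint, ContinuousLinearMap.adjoint_comp,
      ContinuousLinearMap.adjoint_adjoint, ContinuousLinearMap.traceCLM_comp_comm,
      (isSelfAdjoint_starProjection P).adjoint_eq]
  rw [ContinuousLinearMap.add_comp, map_add, h5, ContinuousLinearMap.traceCLM_comp_comm,
    ← ContinuousLinearMap.traceCLM_apply]
  simp [ContinuousLinearMap.det]

theorem ContinuousLinearMap.exists_abs_subspaceJacobian_sub_one_le (K : ℝ) :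
    ∃ C, ∀ᶠ t in 𝓝[≥] (0 : ℝ), ∀ (B : E →L[ℝ] E) (P : Submodule ℝ E), ‖B‖ ≤ K →
      |(1 + t • B).subspaceJacobian P - 1| ≤ C * t := by
  obtain ⟨C, δ, hC, hδ, h⟩ := ContinuousLinearMap.exists_abs_det_one_add_sub_one_le (E := E)
  set L := 2 * |K| + |K| ^ 2 with hL
  have hsmall : ∀ᶠ t in 𝓝[≥] (0 : ℝ), L * t < δ := by
    have : Tendsto (fun t : ℝ => L * t) (𝓝 0) (𝓝 (L * 0)) :=
      (continuous_const.mul continuous_id).tendsto 0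
    exact nhdsWithin_le_nhds (this.eventually (gt_mem_nhds (by simpa using hδ)))
  refine ⟨C * L, ?_⟩
  filter_upwards [hsmall, PreShape.Icc_zero_one_mem_nhdsGE] with t ht ht1 B P hB
  have hBK : ‖B‖ ≤ |K| := hB.trans (le_abs_self K)
  have hBa : ‖B.adjoint‖ ≤ |K| := by simpa using hBK
  have hZ : ‖((1 + t • B).adjoint.comp (1 + t • B) - 1).comp P.starProjection‖ ≤ L * t := by
    rw [ContinuousLinearMap.adjoint_comp_self_one_add_smul]
    calc ‖(t • (B + B.adjoint) + t ^ 2 • B.adjoint.comp B).comp P.starProjection‖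
        ≤ ‖t • (B + B.adjoint) + t ^ 2 • B.adjoint.comp B‖ * 1 :=
          (ContinuousLinearMap.opNorm_comp_le _ _).trans
            (by gcongr; exact P.starProjection_norm_le)
      _ ≤ t * (‖B‖ + ‖B.adjoint‖) + t ^ 2 * (‖B.adjoint‖ * ‖B‖) := by
          rw [mul_one]
          refine (norm_add_le _ _).trans ?_
          rw [norm_smul, norm_smul, Real.norm_of_nonneg ht1.1, Real.norm_of_nonneg (by positivity)]
          have := ht1.1
          gcongr
          · exact norm_add_le _ _
          · exact ContinuousLinearMap.opNorm_comp_le _ _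
      _ ≤ t * (|K| + |K|) + (t * 1) * (|K| * |K|) := by
          rw [sq]
          have := ht1.1
          have := ht1.2
          gcongr
      _ = L * t := by rw [hL]; ring
  have h1 := h _ (hZ.trans_lt ht)
  rw [← ContinuousLinearMap.subspaceJacobian_sq] at h1
  set j := (1 + t • B).subspaceJacobian P
  have hj : 0 ≤ j := ContinuousLinearMap.subspaceJacobian_nonneg _ _
  -- Since `j ≥ 0`, the factor `j + 1 ≥ 1` can be inserted, which passes to `j²` without a root
  -- estimate.
  calc |j - 1| ≤ |j - 1| * (j + 1) := le_mul_of_one_le_right (abs_nonneg _) (by linarith)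
    _ = |j ^ 2 - 1| := by
      rw [show j ^ 2 - 1 = (j - 1) * (j + 1) by ring, abs_mul, abs_of_nonneg (by linarith : 0 ≤ j + 1)]
    _ ≤ C * (L * t) := h1.trans (by gcongr)
    _ = _ := by ring

theorem ContinuousLinearMap.exists_abs_abs_det_one_add_smul_sub_one_le (K : ℝ) :
    ∃ C, ∀ᶠ t in 𝓝[≥] (0 : ℝ), ∀ B : E →L[ℝ] E, ‖B‖ ≤ K → |(|(1 + t • B).det| - 1)| ≤ C * t := by
  obtain ⟨C, δ, hC, hδ, h⟩ := ContinuousLinearMap.exists_abs_det_one_add_sub_one_le (E := E)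
  have hsmall : ∀ᶠ t in 𝓝[≥] (0 : ℝ), |K| * t < δ := by
    have : Tendsto (fun t : ℝ => |K| * t) (𝓝 0) (𝓝 (|K| * 0)) :=
      (continuous_const.mul continuous_id).tendsto 0
    exact nhdsWithin_le_nhds (this.eventually (gt_mem_nhds (by simpa using hδ)))
  refine ⟨C * |K|, ?_⟩
  filter_upwards [hsmall, self_mem_nhdsWithin] with t ht ht0 B hB
  have hZ : ‖t • B‖ ≤ |K| * t := by
    rw [norm_smul, Real.norm_of_nonneg ht0, mul_comm]
    exact mul_le_mul_of_nonneg_right (hB.trans (le_abs_self K)) ht0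
  calc |(|(1 + t • B).det| - 1)| = |(|(1 + t • B).det| - |1|)| := by rw [abs_one]
    _ ≤ |(1 + t • B).det - 1| := abs_abs_sub_abs_le_abs_sub _ _
    _ ≤ C * ‖t • B‖ := h _ (hZ.trans_lt ht)
    _ ≤ C * (|K| * t) := by gcongr
    _ = _ := by ring

/-- The determinant is `1` at `t = 0`, hence positive nearby, and the absolute value has no effect.
-/
theorem ContinuousLinearMap.hasDerivAt_abs_det_one_add_smul (B : E →L[ℝ] E) :
    HasDerivAt (fun t : ℝ => |(1 + t • B).det|) (LinearMap.trace ℝ E B.toLinearMap) 0 := by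
  have h := ContinuousLinearMap.hasDerivAt_det_one_add_smul B
  refine h.congr_of_eventuallyEq ?_
  have h0 : (0 : ℝ) < (1 + (0 : ℝ) • B).det := by simp [ContinuousLinearMap.det]
  filter_upwards [h.continuousAt.eventually (lt_mem_nhds h0)] with t ht using abs_of_pos ht

end Determinant

namespace PreShape

/-! ### Tangent spaces of hypersurfaces -/

section Tangent

variable {n : ℕ} {Γ : Set (Ambient n)}

/-- Tangent cones are carried along by derivatives, so the straightening chart and its inverse
identify the tangent cone of `Γ` with that of the flat piece. The defining form is nonzero because
the derivative of the chart is invertible. -/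
theorem tangentSubspace_eq_ker {Φ : OpenPartialHomeomorph (Ambient n) (EuclideanSpace ℝ (Fin n) × ℝ)}
    (hΦ : ContDiffOn ℝ ∞ Φ Φ.source) (hΦ' : ContDiffOn ℝ ∞ Φ.symm Φ.target)
    (hΓ : Γ ∩ Φ.source = {x ∈ Φ.source | (Φ x).2 = 0}) {y : Ambient n} (hy : y ∈ Γ)
    (hys : y ∈ Φ.source) :
    tangentSubspace Γ y = LinearMap.ker (fderiv ℝ (fun x => (Φ x).2) y).toLinearMap ∧
      fderiv ℝ (fun x => (Φ x).2) y ≠ 0 := by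
  have hΦy : Φ y ∈ Φ.target := Φ.map_source hys
  have hd : HasFDerivAt Φ (fderiv ℝ Φ y) y :=
    ((hΦ.contDiffAt (Φ.open_source.mem_nhds hys)).differentiableAt (by simp)).hasFDerivAt
  have hd' : HasFDerivAt Φ.symm (fderiv ℝ Φ.symm (Φ y)) (Φ y) :=
    ((hΦ'.contDiffAt (Φ.open_target.mem_nhds hΦy)).differentiableAt (by simp)).hasFDerivAt
  have hg : HasFDerivAt (fun x => (Φ x).2)
      ((ContinuousLinearMap.snd ℝ (EuclideanSpace ℝ (Fin n)) ℝ).comp (fderiv ℝ Φ y)) y := hd.snd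
  rw [hg.fderiv]
  have hleft : (fderiv ℝ Φ.symm (Φ y)).comp (fderiv ℝ Φ y) = ContinuousLinearMap.id ℝ _ := by
    refine (hd'.comp y hd).unique ((hasFDerivAt_id y).congr_of_eventuallyEq ?_)
    filter_upwards [Φ.open_source.mem_nhds hys] with z hz using Φ.left_inv hz
  have hright : (fderiv ℝ Φ y).comp (fderiv ℝ Φ.symm (Φ y)) = ContinuousLinearMap.id ℝ _ := by
    have hd2 : HasFDerivAt Φ (fderiv ℝ Φ y) (Φ.symm (Φ y)) := by rwa [Φ.left_inv hys]
    refine (hd2.comp (Φ y) hd').unique ((hasFDerivAt_id (Φ y)).congr_of_eventuallyEq ?_)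
    filter_upwards [Φ.open_target.mem_nhds hΦy] with z hz using Φ.right_inv hz
  have hΦy0 : (Φ y).2 = 0 := by
    have : y ∈ Γ ∩ Φ.source := ⟨hy, hys⟩
    rw [hΓ] at this
    exact this.2
  constructor
  · refine le_antisymm (Submodule.span_le.2 fun v hv => ?_) fun v hv => Submodule.subset_span ?_
    · rw [← tangentConeAt_inter_nhds (Φ.open_source.mem_nhds hys)] at hv
      have h1 := hg.hasFDerivWithinAt.mapsTo_tangent_cone hv
      have h2 : (fun x => (Φ x).2) '' (Γ ∩ Φ.source) ⊆ {0} := by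
        rintro _ ⟨z, hz, rfl⟩
        rw [hΓ] at hz
        exact hz.2
      -- The second coordinate sends `Γ` near `y` into `{0}`, which has no accumulation point, so
      -- the image of a tangent vector is zero.
      have h3 := tangentConeAt_subset_zero (𝕜 := ℝ) (x := (Φ y).2)
        (by
          intro h
          obtain ⟨z, ⟨-, hz⟩, hne⟩ := accPt_iff_nhds.1 h univ univ_mem
          exact hne (hz.trans hΦy0.symm)) (tangentConeAt_mono h2 h1)
      simpa using h3
    · set w := fderiv ℝ Φ y v with hw
      have hw0 : w.2 = 0 := by simpa using hv
      have h1 : w ∈ tangentConeAt ℝ ({z : EuclideanSpace ℝ (Fin n) × ℝ | z.2 = 0} ∩ Φ.target)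
          (Φ y) := by
        rw [tangentConeAt_inter_nhds (Φ.open_target.mem_nhds hΦy)]
        have h2 : segment ℝ (Φ y) (Φ y + w) ⊆ {z : EuclideanSpace ℝ (Fin n) × ℝ | z.2 = 0} := by
          rintro _ ⟨a, b, -, -, -, rfl⟩
          simp [hΦy0, hw0]
        simpa using mem_tangentConeAt_of_segment_subset h2
      have h2 := hd'.hasFDerivWithinAt.mapsTo_tangent_cone h1
      rw [Φ.left_inv hys] at h2
      have h3 : fderiv ℝ Φ.symm (Φ y) w = v := by
        simpa using congrArg (fun L => L v) hleft
      rw [h3] at h2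
      refine tangentConeAt_mono ?_ h2
      rintro _ ⟨z, ⟨hz0, hz⟩, rfl⟩
      have : Φ.symm z ∈ {x ∈ Φ.source | (Φ x).2 = 0} :=
        ⟨Φ.map_target hz, by rw [Φ.right_inv hz]; exact hz0⟩
      rw [← hΓ] at this
      exact this.1
  · intro h0
    have h1 := congrArg (fun L => L (fderiv ℝ Φ.symm (Φ y) (0, 1))) h0
    have h2 := congrArg (fun L => (L (0, 1)).2) hright
    simp at h1 h2
    rw [h1] at h2
    exact zero_ne_one h2

/-- Near each point of a hypersurface the tangent spaces are the kernels of continuously varying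
nonzero linear forms `ℓ`. -/
theorem IsSmoothHypersurface.exists_conormal (hΓ : IsSmoothHypersurface Γ) {x : Ambient n}
    (hx : x ∈ Γ) :
    ∃ ℓ : Ambient n → Ambient n →L[ℝ] ℝ, ContinuousAt ℓ x ∧
      (∀ᶠ y in 𝓝[Γ] x, tangentSubspace Γ y = LinearMap.ker (ℓ y).toLinearMap ∧ ℓ y ≠ 0) ∧
      (fun p : Ambient n × Ambient n => ℓ x (p.1 - p.2)) =o[𝓝[Γ ×ˢ Γ] (x, x)]
        fun p => p.1 - p.2 := by
  obtain ⟨Φ, hxs, hΦ, hΦ', hΓ'⟩ := hΓ x hx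
  have hU := Φ.open_source.mem_nhds hxs
  have hg : ContDiffOn ℝ ∞ (fun x => (Φ x).2) Φ.source := hΦ.snd
  refine ⟨fun y => fderiv ℝ (fun x => (Φ x).2) y,
    (hg.continuousOn_fderiv_of_isOpen Φ.open_source (by simp)).continuousAt hU, ?_, ?_⟩
  · filter_upwards [self_mem_nhdsWithin, nhdsWithin_le_nhds hU] with y hy hys
    exact tangentSubspace_eq_ker hΦ hΦ' hΓ' hy hys
  -- The defining function vanishes at both endpoints of a chord of `Γ`, so its strict derivative on
  -- the chord is all remainder.
  · have h1 := ((hg.contDiffAt hU).hasStrictFDerivAt (by simp)).isLittleO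
    refine ((h1.mono (nhdsWithin_le_nhds (s := Γ ×ˢ Γ))).congr' ?_ EventuallyEq.rfl).neg_left.congr_left
      fun p => neg_neg _
    have hU2 : Φ.source ×ˢ Φ.source ∈ 𝓝 (x, x) := prod_mem_nhds hU hU
    filter_upwards [self_mem_nhdsWithin, nhdsWithin_le_nhds hU2] with p hp hps
    have h2 : p.1 ∈ Γ ∩ Φ.source := ⟨hp.1, hps.1⟩
    have h3 : p.2 ∈ Γ ∩ Φ.source := ⟨hp.2, hps.2⟩
    rw [hΓ'] at h2 h3
    simp [h2.2, h3.2]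

/-- The projection depends explicitly on `ℓ`, so continuity of the conormal form passes to the
tangent projection. -/
theorem starProjection_ker {E : Type*} [NormedAddCommGroup E] [InnerProductSpace ℝ E]
    [FiniteDimensional ℝ E] (ℓ : E →L[ℝ] ℝ) :
    (LinearMap.ker ℓ.toLinearMap).starProjection =
      1 - (‖ℓ‖ ^ 2)⁻¹ • ℓ.smulRight ((InnerProductSpace.toDual ℝ E).symm ℓ) := by
  set u := (InnerProductSpace.toDual ℝ E).symm ℓ with hu
  have h1 : ∀ v, ℓ v = inner ℝ u v := fun v => by simp [hu]
  have h2 : LinearMap.ker ℓ.toLinearMap = (ℝ ∙ u)ᗮ := by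
    ext v
    simp [Submodule.mem_orthogonal_singleton_iff_inner_right, h1]
  have h3 : ‖ℓ‖ = ‖u‖ := by simp [hu]
  simp_rw [h2]
  rw [Submodule.starProjection_orthogonal']
  ext v : 1
  simp [Submodule.starProjection_singleton, h1, h3, smul_smul, div_eq_inv_mul]

theorem IsSmoothHypersurface.continuousOn_starProjection (hΓ : IsSmoothHypersurface Γ) :
    ContinuousOn (fun x => (tangentSubspace Γ x).starProjection) Γ := by
  intro x hx
  obtain ⟨ℓ, hℓ, hker, -⟩ := hΓ.exists_conormal hx
  have h0 : ‖ℓ x‖ ^ 2 ≠ 0 := by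
    have := (hker.self_of_nhdsWithin hx).2
    simpa using this
  have hc : ContinuousAt (fun y => 1 - (‖ℓ y‖ ^ 2)⁻¹ •
      (ℓ y).smulRight ((InnerProductSpace.toDual ℝ (Ambient n)).symm (ℓ y))) x := by
    refine continuousAt_const.sub (((hℓ.norm.pow 2).inv₀ h0).smul ?_)
    exact ((ContinuousLinearMap.smulRightL ℝ (Ambient n) (Ambient n)).isBoundedBilinearMap.continuous.continuousAt.comp
      (hℓ.prodMk ((InnerProductSpace.toDual ℝ (Ambient n)).symm.continuous.continuousAt.comp hℓ)))
  refine hc.continuousWithinAt.congr_of_eventuallyEq ?_ ?_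
  · filter_upwards [hker] with y hy
    simp_rw [hy.1, starProjection_ker]
  · simp_rw [(hker.self_of_nhdsWithin hx).1, starProjection_ker]

theorem IsSmoothHypersurface.finrank_tangentSubspace (hΓ : IsSmoothHypersurface Γ) {x : Ambient n}
    (hx : x ∈ Γ) : Module.finrank ℝ (tangentSubspace Γ x) = n := by
  obtain ⟨ℓ, -, hker, -⟩ := hΓ.exists_conormal hx
  obtain ⟨h1, h2⟩ := hker.self_of_nhdsWithin hx
  have h3 := (ℓ x).toLinearMap.finrank_range_add_finrank_ker
  have h4 : LinearMap.range (ℓ x).toLinearMap = ⊤ :=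
    LinearMap.range_eq_top.2 (LinearMap.surjective (by
      intro h; exact h2 (ContinuousLinearMap.coe_injective h)))
  rw [h4, finrank_top, Module.finrank_self, finrank_euclideanSpace_fin] at h3
  rw [h1]
  omega

/-- The normal part of a chord is a multiple of `ℓ x` evaluated on it, which is of lower order than
the chord. -/
theorem IsSmoothHypersurface.isLittleO_sub_starProjection (hΓ : IsSmoothHypersurface Γ)
    {x : Ambient n} (hx : x ∈ Γ) :
    (fun p : Ambient n × Ambient n =>
        (p.1 - p.2) - (tangentSubspace Γ x).starProjection (p.1 - p.2))
      =o[𝓝[Γ ×ˢ Γ] (x, x)] fun p => p.1 - p.2 := by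
  obtain ⟨ℓ, -, hker, hℓ⟩ := hΓ.exists_conormal hx
  simp_rw [(hker.self_of_nhdsWithin hx).1, starProjection_ker]
  refine Asymptotics.IsBigO.trans_isLittleO (Asymptotics.IsBigO.of_bound
    ((‖ℓ x‖ ^ 2)⁻¹ * ‖(InnerProductSpace.toDual ℝ (Ambient n)).symm (ℓ x)‖)
    (Eventually.of_forall fun p => le_of_eq ?_)) hℓ
  simp [norm_smul]
  ring

/-- `Γ` is relatively closed in the union of its chart domains, hence a difference of two open sets.
-/
theorem IsSmoothHypersurface.measurableSet (hΓ : IsSmoothHypersurface Γ) : MeasurableSet Γ := by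
  choose Φ hx hΦ _ hΓ' using fun p : Γ => hΓ p p.2
  have hU : IsOpen (⋃ p, (Φ p).source) := isOpen_iUnion fun p => (Φ p).open_source
  have hW : IsOpen (⋃ p, (Φ p).source \ Γ) := by
    refine isOpen_iUnion fun p => ?_
    have : (Φ p).source \ Γ = (Φ p).source ∩ (fun x => (Φ p x).2) ⁻¹' {0}ᶜ := by
      ext z
      have h := Set.ext_iff.1 (hΓ' p) z
      simp only [mem_inter_iff, mem_ofPred_eq] at h
      simp only [Set.mem_sdiff, mem_inter_iff, mem_preimage, mem_compl_iff, mem_singleton_iff]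
      tauto
    rw [this]
    exact (hΦ p).snd.continuousOn.isOpen_inter_preimage (Φ p).open_source
      isOpen_compl_singleton
  have : Γ = (⋃ p, (Φ p).source) \ ⋃ p, (Φ p).source \ Γ := by
    ext z
    simp only [Set.mem_sdiff, mem_iUnion, not_exists, not_and, not_not]
    exact ⟨fun hz => ⟨⟨⟨z, hz⟩, hx ⟨z, hz⟩⟩, fun _ _ => hz⟩, fun ⟨⟨p, hzp⟩, h⟩ => h p hzp⟩
  rw [this]
  exact hU.measurableSet.diff hW.measurableSet

end Tangent

end PreShape

/-! ### Surface measure of images of hypersurfaces -/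

section HausdorffComparison

open scoped NNReal ENNReal

theorem LipschitzOnWith.euclideanHausdorffMeasure_image_le {X Y : Type*} [MetricSpace X]
    [MeasurableSpace X] [BorelSpace X] [MetricSpace Y] [MeasurableSpace Y] [BorelSpace Y]
    {K : ℝ≥0} {f : X → Y} {s : Set X} (h : LipschitzOnWith K f s) (d : ℕ) :
    μHE[d] (f '' s) ≤ (K : ℝ≥0∞) ^ d * μHE[d] s := by
  simp_rw [Measure.euclideanHausdorffMeasure_def, Measure.smul_apply, ENNReal.smul_def, smul_eq_mul]
  rw [mul_left_comm]
  gcongr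
  simpa using h.hausdorffMeasure_image_le (d := (d : ℝ)) (by positivity)

/-- The hypothesis makes `g x ↦ f x` a well-defined `K`-Lipschitz map on `g '' s`, even where `g` is
not injective. -/
theorem euclideanHausdorffMeasure_image_le_of_dist_le {X Y Z : Type*} [MetricSpace Y]
    [MeasurableSpace Y] [BorelSpace Y] [MetricSpace Z] [MeasurableSpace Z] [BorelSpace Z]
    {f : X → Y} {g : X → Z} {s : Set X} {K : ℝ≥0}
    (h : ∀ x ∈ s, ∀ y ∈ s, dist (f x) (f y) ≤ K * dist (g x) (g y)) (d : ℕ) :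
    μHE[d] (f '' s) ≤ (K : ℝ≥0∞) ^ d * μHE[d] (g '' s) := by
  rcases s.eq_empty_or_nonempty with rfl | ⟨x₀, hx₀⟩
  · simp
  have : Nonempty X := ⟨x₀⟩
  have hinv : ∀ x ∈ s, Function.invFunOn g s (g x) ∈ s ∧ g (Function.invFunOn g s (g x)) = g x :=
    fun x hx => Function.invFunOn_pos ⟨x, hx, rfl⟩
  have hf : f '' s = (f ∘ Function.invFunOn g s) '' (g '' s) := by
    rw [image_image]
    refine image_congr fun x hx => ?_
    have h1 := h x hx _ (hinv x hx).1
    rw [(hinv x hx).2, dist_self, mul_zero] at h1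
    exact dist_le_zero.1 h1
  rw [hf]
  refine LipschitzOnWith.euclideanHausdorffMeasure_image_le (LipschitzOnWith.of_dist_le_mul ?_) d
  rintro _ ⟨x, hx, rfl⟩ _ ⟨y, hy, rfl⟩
  have h1 := h _ (hinv x hx).1 _ (hinv y hy).1
  rwa [(hinv x hx).2, (hinv y hy).2] at h1

theorem Asymptotics.IsEquivalent.eventually_norm_le {α E : Type*} [NormedAddCommGroup E]
    {u v : α → E} {l : Filter α} (h : Asymptotics.IsEquivalent l u v) {K : ℝ} (hK : 1 < K) :
    ∀ᶠ x in l, ‖u x‖ ≤ K * ‖v x‖ := by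
  filter_upwards [h.isLittleO.def (sub_pos.2 hK)] with x hx
  have h1 : ‖u x‖ ≤ ‖u x - v x‖ + ‖v x‖ := by
    simpa using norm_add_le (u x - v x) (v x)
  have h2 : ‖u x - v x‖ ≤ (K - 1) * ‖v x‖ := hx
  linarith

end HausdorffComparison

namespace PreShape

/-! ### The area formula on a smooth hypersurface -/

section AreaFormula

open scoped NNReal ENNReal

variable {n : ℕ} {Γ : Set (Ambient n)} {T : Ambient n → Ambient n}

/-- Short chords of `Γ` are asymptotic to their tangential projections, and strict differentiability
makes their `T`-images asymptotic to `A` of these. Injectivity of `A` ensures that the remainders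
are small relative to `A` of the projection. -/
theorem IsSmoothHypersurface.eventually_norm_le (hΓ : IsSmoothHypersurface Γ) {x : Ambient n}
    (hx : x ∈ Γ) {A : Ambient n →L[ℝ] Ambient n} (hT : HasStrictFDerivAt T A x)
    (hA : Function.Injective A) {K : ℝ} (hK : 1 < K) :
    ∀ᶠ p in 𝓝[Γ ×ˢ Γ] (x, x),
      ‖p.1 - p.2‖ ≤ K * ‖(tangentSubspace Γ x).starProjection (p.1 - p.2)‖ ∧
      ‖T p.1 - T p.2‖ ≤ K * ‖A ((tangentSubspace Γ x).starProjection (p.1 - p.2))‖ ∧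
      ‖A ((tangentSubspace Γ x).starProjection (p.1 - p.2))‖ ≤ K * ‖T p.1 - T p.2‖ := by
  set P := (tangentSubspace Γ x).starProjection
  set l := 𝓝[Γ ×ˢ Γ] (x, x)
  have h1 := hΓ.isLittleO_sub_starProjection hx
  have e1 : Asymptotics.IsEquivalent l (fun p : Ambient n × Ambient n => P (p.1 - p.2))
      (fun p => p.1 - p.2) := h1.symm
  obtain ⟨c, -, hc⟩ := A.toLinearMap.exists_antilipschitzWith (LinearMap.ker_eq_bot.2 hA)
  have h2 : (fun p : Ambient n × Ambient n => P (p.1 - p.2)) =O[l]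
      fun p => A (P (p.1 - p.2)) := by
    refine Asymptotics.IsBigO.of_bound c (Eventually.of_forall fun p => ?_)
    have := hc.le_mul_dist (P (p.1 - p.2)) 0
    simpa using this
  have h3 : (fun p : Ambient n × Ambient n => p.1 - p.2) =O[l] fun p => A (P (p.1 - p.2)) :=
    e1.symm.isBigO.trans h2
  have h4 : (fun p : Ambient n × Ambient n => T p.1 - T p.2 - A (p.1 - p.2)) =o[l]
      fun p => p.1 - p.2 := hT.isLittleO.mono nhdsWithin_le_nhds
  have h5 : (fun p : Ambient n × Ambient n => A ((p.1 - p.2) - P (p.1 - p.2))) =o[l]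
      fun p => p.1 - p.2 := (A.isBigO_comp _ _).trans_isLittleO h1
  have e2 : Asymptotics.IsEquivalent l (fun p : Ambient n × Ambient n => T p.1 - T p.2)
      (fun p => A (P (p.1 - p.2))) := by
    refine ((h4.add h5).trans_isBigO h3).congr_left fun p => ?_
    simp
  filter_upwards [e1.symm.eventually_norm_le hK, e2.eventually_norm_le hK,
    e2.symm.eventually_norm_le hK] with p a b c using ⟨a, b, c⟩

/-- Both `S` and `T '' S` are compared with the projection of `S` to the tangent plane, on which `A`
scales measure exactly by the Jacobian. Each comparison costs at most `K ^ n`, hence the exponent `2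
* n`. -/
theorem IsSmoothHypersurface.exists_nhds_measure_image_le (hΓ : IsSmoothHypersurface Γ)
    {x : Ambient n} (hx : x ∈ Γ) {A : Ambient n →L[ℝ] Ambient n} (hT : HasStrictFDerivAt T A x)
    (hA : Function.Injective A) {K : ℝ≥0} (hK : 1 < K) :
    ∃ U ∈ 𝓝 x, ∀ S ⊆ Γ ∩ U,
      μHE[n] (T '' S) ≤
        (K : ℝ≥0∞) ^ (2 * n) * (ENNReal.ofReal (A.subspaceJacobian (tangentSubspace Γ x)) * μHE[n] S) ∧
      ENNReal.ofReal (A.subspaceJacobian (tangentSubspace Γ x)) * μHE[n] S ≤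
        (K : ℝ≥0∞) ^ (2 * n) * μHE[n] (T '' S) := by
  have h := hΓ.eventually_norm_le hx hT hA (K := K) (by exact_mod_cast hK)
  rw [eventually_nhdsWithin_iff, nhds_prod_eq] at h
  obtain ⟨U, hU, h⟩ := mem_prod_self_iff.1 h
  set P := tangentSubspace Γ x with hP
  have hrank : Module.finrank ℝ P = n := hΓ.finrank_tangentSubspace hx
  refine ⟨U, hU, fun S hS => ?_⟩
  have hS' : ∀ y ∈ S, ∀ z ∈ S, _ := fun y hy z hz =>
    h (mk_mem_prod (hS hy).2 (hS hz).2) (mk_mem_prod (hS hy).1 (hS hz).1)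
  set π : Ambient n → P := fun y => P.orthogonalProjectionOnto y with hπ
  set B : P →ₗ[ℝ] Ambient n := A.toLinearMap ∘ₗ P.subtype with hB
  have hBπ : ∀ y z, dist (B (π y)) (B (π z)) = ‖A (P.starProjection (y - z))‖ := by
    intro y z
    rw [dist_eq_norm, ← map_sub, hπ]
    simp only [← map_sub]
    rfl
  have hπd : ∀ y z, dist (π y) (π z) = ‖P.starProjection (y - z)‖ := by
    intro y z
    rw [dist_eq_norm, hπ]
    simp only [← map_sub]
    rfl
  have hscale : μHE[n] ((fun y => B (π y)) '' S) =
      ENNReal.ofReal (A.subspaceJacobian P) * μHE[n] (π '' S) := by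
    have := B.euclideanHausdorffMeasure_image (π '' S)
    rw [hrank, image_image] at this
    exact this
  have m1 : μHE[n] (π '' S) ≤ μHE[n] S := by
    have := euclideanHausdorffMeasure_image_le_of_dist_le (f := π) (g := id) (s := S) (K := 1)
      (fun y _ z _ => by
        rw [hπd, NNReal.coe_one, one_mul, id, id, dist_eq_norm]
        exact P.norm_starProjection_apply_le _) n
    simpa using this
  have m2 : μHE[n] S ≤ (K : ℝ≥0∞) ^ n * μHE[n] (π '' S) := by
    have := euclideanHausdorffMeasure_image_le_of_dist_le (f := id) (g := π) (s := S) (K := K)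
      (fun y hy z hz => by
        rw [hπd, id, id, dist_eq_norm]
        exact (hS' y hy z hz).1) n
    simpa using this
  have m3 : μHE[n] (T '' S) ≤ (K : ℝ≥0∞) ^ n * μHE[n] ((fun y => B (π y)) '' S) :=
    euclideanHausdorffMeasure_image_le_of_dist_le (fun y hy z hz => by
      rw [hBπ, dist_eq_norm]
      exact (hS' y hy z hz).2.1) n
  have m4 : μHE[n] ((fun y => B (π y)) '' S) ≤ (K : ℝ≥0∞) ^ n * μHE[n] (T '' S) :=
    euclideanHausdorffMeasure_image_le_of_dist_le (fun y hy z hz => by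
      rw [hBπ, dist_eq_norm]
      exact (hS' y hy z hz).2.2) n
  rw [hscale] at m3 m4
  have hK1 : (1 : ℝ≥0∞) ≤ K := by exact_mod_cast hK.le
  constructor
  · calc μHE[n] (T '' S) ≤ (K : ℝ≥0∞) ^ n * (ENNReal.ofReal (A.subspaceJacobian P) * μHE[n] S) :=
          m3.trans (by gcongr)
      _ ≤ _ := by
          gcongr
          omega
  · calc ENNReal.ofReal (A.subspaceJacobian P) * μHE[n] S
        ≤ ENNReal.ofReal (A.subspaceJacobian P) * ((K : ℝ≥0∞) ^ n * μHE[n] (π '' S)) := by gcongr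
      _ = (K : ℝ≥0∞) ^ n * (ENNReal.ofReal (A.subspaceJacobian P) * μHE[n] (π '' S)) :=
          mul_left_comm _ _ _
      _ ≤ (K : ℝ≥0∞) ^ n * ((K : ℝ≥0∞) ^ n * μHE[n] (T '' S)) := by gcongr
      _ = _ := by rw [← mul_assoc, ← pow_add, two_mul]

variable {T' : Ambient n → Ambient n →L[ℝ] Ambient n}

theorem IsSmoothHypersurface.continuousOn_subspaceJacobian (hΓ : IsSmoothHypersurface Γ)
    (hT' : ContinuousOn T' Γ) :
    ContinuousOn (fun x => (T' x).subspaceJacobian (tangentSubspace Γ x)) Γ := by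
  simp_rw [ContinuousLinearMap.subspaceJacobian_eq_sqrt]
  refine Real.continuous_sqrt.comp_continuousOn
    (ContinuousLinearMap.continuous_det.comp_continuousOn (continuousOn_const.add ?_))
  refine ContinuousOn.clm_comp (ContinuousOn.sub ?_ continuousOn_const) hΓ.continuousOn_starProjection
  exact ((ContinuousLinearMap.adjoint (𝕜 := ℝ) (E := Ambient n)
    (F := Ambient n)).continuous.comp_continuousOn hT').clm_comp hT'

theorem subspaceJacobian_pos {A : Ambient n →L[ℝ] Ambient n} (hA : Function.Injective A)
    (P : Submodule ℝ (Ambient n)) : 0 < A.subspaceJacobian P := by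
  refine (A.subspaceJacobian_nonneg P).lt_of_ne' fun h => ?_
  refine LinearMap.normDet_eq_zero_iff_ker_ne_bot.1 h (LinearMap.ker_eq_bot.2 ?_)
  exact hA.comp Subtype.val_injective

/-- The Jacobian is continuous and positive on `Γ`, so freezing it at `x` costs one more factor `K`
on a small neighbourhood. -/
theorem IsSmoothHypersurface.exists_nhds_measure_image_le_lintegral (hΓ : IsSmoothHypersurface Γ)
    (hT : ∀ x ∈ Γ, HasStrictFDerivAt T (T' x) x) (hT' : ContinuousOn T' Γ)
    (hinj : ∀ x ∈ Γ, Function.Injective (T' x)) {K : ℝ≥0} (hK : 1 < K)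
    {x : Ambient n} (hx : x ∈ Γ) :
    ∃ U ∈ 𝓝 x, ∀ S ⊆ Γ ∩ U, MeasurableSet S →
      μHE[n] (T '' S) ≤ (K : ℝ≥0∞) ^ (2 * n + 1) *
        ∫⁻ y in S, ENNReal.ofReal ((T' y).subspaceJacobian (tangentSubspace Γ y)) ∂μHE[n] ∧
      ∫⁻ y in S, ENNReal.ofReal ((T' y).subspaceJacobian (tangentSubspace Γ y)) ∂μHE[n] ≤
        (K : ℝ≥0∞) ^ (2 * n + 1) * μHE[n] (T '' S) := by
  obtain ⟨U, hU, h⟩ := hΓ.exists_nhds_measure_image_le hx (hT x hx) (hinj x hx) hK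
  set J : Ambient n → ℝ := fun y => (T' y).subspaceJacobian (tangentSubspace Γ y) with hJ
  have hJ0 : ∀ y ∈ Γ, 0 < J y := fun y hy => subspaceJacobian_pos (hinj y hy) _
  have hJc : ContinuousWithinAt J Γ x := hΓ.continuousOn_subspaceJacobian hT' x hx
  have hK' : (1 : ℝ) < K := by exact_mod_cast hK
  have h1 : ∀ᶠ y in 𝓝[Γ] x, J y < K * J x :=
    hJc.eventually (gt_mem_nhds (by nlinarith [hJ0 x hx]))
  have h2 : ∀ᶠ y in 𝓝[Γ] x, J x < K * J y :=
    (hJc.const_mul (K : ℝ)).eventually (lt_mem_nhds (by nlinarith [hJ0 x hx]))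
  have h3 := h1.and h2
  rw [eventually_nhdsWithin_iff] at h3
  refine ⟨U ∩ {y | y ∈ Γ → J y < K * J x ∧ J x < K * J y}, inter_mem hU h3, fun S hS hSm => ?_⟩
  obtain ⟨a, b⟩ := h S fun y hy => ⟨(hS hy).1, (hS hy).2.1⟩
  have c1 : ENNReal.ofReal (J x) * μHE[n] S ≤ K * ∫⁻ y in S, ENNReal.ofReal (J y) ∂μHE[n] := by
    rw [← lintegral_const_mul' _ _ ENNReal.coe_ne_top, ← setLIntegral_const]
    refine setLIntegral_mono' hSm fun y hy => ?_
    rw [← ENNReal.ofReal_coe_nnreal, ← ENNReal.ofReal_mul K.coe_nonneg]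
    exact ENNReal.ofReal_le_ofReal ((hS hy).2.2 (hS hy).1).2.le
  have c2 : ∫⁻ y in S, ENNReal.ofReal (J y) ∂μHE[n] ≤ K * (ENNReal.ofReal (J x) * μHE[n] S) := by
    rw [← mul_assoc, ← setLIntegral_const]
    refine setLIntegral_mono' hSm fun y hy => ?_
    rw [← ENNReal.ofReal_coe_nnreal, ← ENNReal.ofReal_mul K.coe_nonneg]
    exact ENNReal.ofReal_le_ofReal ((hS hy).2.2 (hS hy).1).1.le
  constructor
  · calc μHE[n] (T '' S) ≤ (K : ℝ≥0∞) ^ (2 * n) * (ENNReal.ofReal (J x) * μHE[n] S) := a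
      _ ≤ (K : ℝ≥0∞) ^ (2 * n) * (K * ∫⁻ y in S, ENNReal.ofReal (J y) ∂μHE[n]) := by gcongr
      _ = _ := by rw [← mul_assoc, ← pow_succ]
  · calc ∫⁻ y in S, ENNReal.ofReal (J y) ∂μHE[n] ≤ K * (ENNReal.ofReal (J x) * μHE[n] S) := c2
      _ ≤ K * ((K : ℝ≥0∞) ^ (2 * n) * μHE[n] (T '' S)) := by gcongr
      _ = _ := by rw [← mul_assoc, ← pow_succ']

/-- The area formula for injective immersions of pieces of a hypersurface. -/
theorem IsSmoothHypersurface.measure_image_eq_lintegral (hΓ : IsSmoothHypersurface Γ)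
    (hT : ∀ x ∈ Γ, HasStrictFDerivAt T (T' x) x) (hT' : ContinuousOn T' Γ)
    (hinj : ∀ x ∈ Γ, Function.Injective (T' x)) (hTinj : InjOn T Γ) {S : Set (Ambient n)}
    (hS : S ⊆ Γ) (hSm : MeasurableSet S) :
    μHE[n] (T '' S) =
      ∫⁻ y in S, ENNReal.ofReal ((T' y).subspaceJacobian (tangentSubspace Γ y)) ∂μHE[n] := by
  set J : Ambient n → ℝ≥0∞ := fun y =>
    ENNReal.ofReal ((T' y).subspaceJacobian (tangentSubspace Γ y)) with hJ
  have key : ∀ K : ℝ≥0, 1 < K →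
      μHE[n] (T '' S) ≤ (K : ℝ≥0∞) ^ (2 * n + 1) * ∫⁻ y in S, J y ∂μHE[n] ∧
      ∫⁻ y in S, J y ∂μHE[n] ≤ (K : ℝ≥0∞) ^ (2 * n + 1) * μHE[n] (T '' S) := by
    intro K hK
    rcases S.eq_empty_or_nonempty with rfl | ⟨x₀, hx₀⟩
    · simp
    choose! U hU h using fun x (hx : x ∈ Γ) =>
      hΓ.exists_nhds_measure_image_le_lintegral hT hT' hinj hK hx
    obtain ⟨t, htS, htc, ht⟩ := TopologicalSpace.countable_cover_nhdsWithin (s := S)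
      (f := fun x => interior (U x))
      fun x hx => nhdsWithin_le_nhds (interior_mem_nhds.2 (hU x (hS hx)))
    have htne : t.Nonempty := by
      obtain ⟨x, hx, -⟩ := mem_iUnion₂.1 (ht hx₀)
      exact ⟨x, hx⟩
    obtain ⟨e, rfl⟩ := htc.exists_eq_range htne
    -- Disjoint pieces make both sides countably additive with the same factor on every piece; for
    -- the images this uses injectivity of `T` on `Γ`.
    set W : ℕ → Set (Ambient n) := disjointed fun k => interior (U (e k)) with hW
    have hWm : ∀ k, MeasurableSet (W k) :=
      MeasurableSet.disjointed fun k => isOpen_interior.measurableSet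
    have hWd : Pairwise (Function.onFun Disjoint W) := disjoint_disjointed _
    have hSW : S = ⋃ k, S ∩ W k := by
      rw [← inter_iUnion, hW, iUnion_disjointed]
      refine (inter_eq_left.2 ?_).symm
      simpa [biUnion_range] using ht
    have hSk : ∀ k, S ∩ W k ⊆ Γ ∩ U (e k) := fun k y hy =>
      ⟨hS hy.1, interior_subset (disjointed_subset _ k hy.2)⟩
    have hSkm : ∀ k, MeasurableSet (S ∩ W k) := fun k => hSm.inter (hWm k)
    have hTc : ContinuousOn T Γ := fun x hx => (hT x hx).continuousAt.continuousWithinAt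
    have hTS : μHE[n] (T '' S) = ∑' k, μHE[n] (T '' (S ∩ W k)) := by
      conv_lhs => rw [hSW, image_iUnion]
      refine measure_iUnion (fun i j hij => ?_) fun k => ?_
      · exact (((hWd hij).mono inter_subset_right inter_subset_right).image hTinj
          (inter_subset_left.trans hS) (inter_subset_left.trans hS) :)
      · exact (hSkm k).image_of_continuousOn_injOn (hTc.mono (inter_subset_left.trans hS))
          (hTinj.mono (inter_subset_left.trans hS))
    have hJS : ∫⁻ y in S, J y ∂μHE[n] = ∑' k, ∫⁻ y in S ∩ W k, J y ∂μHE[n] := by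
      conv_lhs => rw [hSW]
      exact lintegral_iUnion hSkm
        (fun i j hij => (hWd hij).mono inter_subset_right inter_subset_right) _
    rw [hTS, hJS, ← ENNReal.tsum_mul_left, ← ENNReal.tsum_mul_left]
    have hk := fun k => h (e k) (hS (htS ⟨k, rfl⟩)) _ (hSk k) (hSkm k)
    exact ⟨ENNReal.tsum_le_tsum fun k => (hk k).1, ENNReal.tsum_le_tsum fun k => (hk k).2⟩
  -- The inequalities hold for every `K > 1` with an exponent independent of `K`, so `K ↓ 1` removes
  -- the factor.
  have lim : ∀ a b : ℝ≥0∞, (∀ K : ℝ≥0, 1 < K → a ≤ (K : ℝ≥0∞) ^ (2 * n + 1) * b) → a ≤ b := by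
    intro a b hab
    have h1 : Tendsto (fun K : ℝ≥0 => (K : ℝ≥0∞) ^ (2 * n + 1) * b) (𝓝[>] 1)
        (𝓝 ((1 : ℝ≥0) ^ (2 * n + 1) * b)) := by
      refine ENNReal.Tendsto.mul_const (Tendsto.mono_left ?_ nhdsWithin_le_nhds) (Or.inl (by simp))
      exact ((ENNReal.continuous_pow _).comp ENNReal.continuous_coe).tendsto 1
    rw [ENNReal.coe_one, one_pow, one_mul] at h1
    refine ge_of_tendsto h1 ?_
    filter_upwards [self_mem_nhdsWithin] with K hK using hab K hK
  exact le_antisymm (lim _ _ fun K hK => (key K hK).1) (lim _ _ fun K hK => (key K hK).2)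

/-- Change of variables for integrals over a hypersurface. -/
theorem IsSmoothHypersurface.setIntegral_image (hΓ : IsSmoothHypersurface Γ) (hTc : Continuous T)
    (hT : ∀ x ∈ Γ, HasStrictFDerivAt T (T' x) x) (hT' : ContinuousOn T' Γ)
    (hinj : ∀ x ∈ Γ, Function.Injective (T' x)) (hTinj : InjOn T Γ) {u : Ambient n → ℝ}
    (hu : Continuous u) :
    ∫ y in T '' Γ, u y ∂μHE[n] =
      ∫ x in Γ, (T' x).subspaceJacobian (tangentSubspace Γ x) * u (T x) ∂μHE[n] := by
  set J : Ambient n → ℝ := fun y => (T' y).subspaceJacobian (tangentSubspace Γ y) with hJ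
  -- The area formula on the sets `Γ ∩ T ⁻¹' B` identifies surface measure on the image with the
  -- pushforward of the weighted surface measure on `Γ`.
  have hmap : (μHE[n] : Measure (Ambient n)).restrict (T '' Γ) =
      (((μHE[n] : Measure (Ambient n)).restrict Γ).withDensity
        fun x => ENNReal.ofReal (J x)).map T := by
    ext B hB
    have hB' := hTc.measurable hB
    rw [Measure.restrict_apply hB, Measure.map_apply hTc.measurable hB, withDensity_apply _ hB',
      Measure.restrict_restrict hB', ← hΓ.measure_image_eq_lintegral hT hT' hinj hTinj
        inter_subset_right (hB'.inter hΓ.measurableSet), inter_comm (T ⁻¹' B), image_inter_preimage,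
      inter_comm]
  rw [hmap, integral_map hTc.measurable.aemeasurable hu.aestronglyMeasurable,
    integral_withDensity_eq_integral_toReal_smul₀ _ (by simp)]
  · simp [hJ, ContinuousLinearMap.subspaceJacobian_nonneg]
  · exact ((hΓ.continuousOn_subspaceJacobian hT').aemeasurable hΓ.measurableSet).ennreal_ofReal

end AreaFormula

end PreShape

namespace PreShape

/-! ### Integrals over perturbed domains and hypersurfaces -/

section Perturbation

variable {n : ℕ} {V : Ambient n → Ambient n}

theorem hasStrictFDerivAt_displace (hV : ContDiff ℝ ∞ V) (t : ℝ) (x : Ambient n) :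
    HasStrictFDerivAt (displace V t) (1 + t • fderiv ℝ V x) x :=
  (hasStrictFDerivAt_id x).add ((hV.contDiffAt.hasStrictFDerivAt (by simp)).const_smul t)

/-- For small `t` the perturbation of identity is an injective immersion on bounded sets. -/
theorem exists_bound_fderiv_and_eventually_injective (hV : ContDiff ℝ ∞ V) {A : Set (Ambient n)}
    (hA : Bornology.IsBounded A) :
    ∃ K : ℝ, (∀ x ∈ A, ‖fderiv ℝ V x‖ ≤ K) ∧ ∀ᶠ t in 𝓝[≥] (0 : ℝ),
      InjOn (displace V t) A ∧
      ∀ x ∈ A, Function.Injective (1 + t • fderiv ℝ V x : Ambient n →L[ℝ] Ambient n) := by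
  obtain ⟨R, hR⟩ := hA.subset_closedBall 0
  obtain ⟨K, hK⟩ := (isCompact_closedBall (0 : Ambient n) R).exists_bound_of_continuousOn
    (hV.continuous_fderiv (by simp)).continuousOn
  have hsmall : ∀ᶠ t in 𝓝[≥] (0 : ℝ), t * K < 1 := by
    have : Tendsto (fun t : ℝ => t * K) (𝓝 0) (𝓝 (0 * K)) :=
      (continuous_id.mul continuous_const).tendsto 0
    exact nhdsWithin_le_nhds (this.eventually (gt_mem_nhds (by simp)))
  refine ⟨K, fun x hx => hK x (hR hx), ?_⟩
  filter_upwards [hsmall, self_mem_nhdsWithin] with t ht ht0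
  have key : ∀ v w : Ambient n, ‖w‖ ≤ K * ‖v‖ → v + t • w = 0 → v = 0 := by
    intro v w hw hv
    have h1 : ‖v‖ ≤ t * K * ‖v‖ := by
      calc ‖v‖ = t * ‖w‖ := by
            rw [eq_neg_of_add_eq_zero_left hv, norm_neg, norm_smul, Real.norm_of_nonneg ht0]
        _ ≤ t * (K * ‖v‖) := mul_le_mul_of_nonneg_left hw ht0
        _ = _ := by ring
    have h2 : ‖v‖ = 0 := by nlinarith [norm_nonneg v]
    exact norm_eq_zero.1 h2
  refine ⟨fun x hx y hy hxy => ?_, fun x hx => ?_⟩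
  -- The mean value inequality is applied on the enclosing ball, since `A` need not be convex.
  · have h1 : ‖V x - V y‖ ≤ K * ‖x - y‖ :=
      (convex_closedBall (0 : Ambient n) R).norm_image_sub_le_of_norm_fderiv_le
        (fun x _ => hV.differentiable (by simp) x) hK (hR hy) (hR hx)
    refine sub_eq_zero.1 (key _ _ h1 ?_)
    have : (x + t • V x) - (y + t • V y) = 0 := sub_eq_zero.2 hxy
    rw [← this, smul_sub]
    abel
  · refine (injective_iff_map_eq_zero (1 + t • fderiv ℝ V x : Ambient n →L[ℝ] Ambient n)).2
      fun v hv => key v (fderiv ℝ V x v) ((fderiv ℝ V x).le_of_opNorm_le (hK _ (hR hx)) v) ?_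
    simpa using hv

variable {S : Type*} {f : S → Ambient n → ℝ} {s : S} {σ : (Ambient n → Ambient n) → ℝ → S}

theorem ShapeDifferentiable.hasDerivWithinAt_integral_domain (hf : ShapeDifferentiable f s σ)
    (hfd : ∀ s, Differentiable ℝ (f s)) (hV : ContDiff ℝ ∞ V) (hσ : σ V 0 = s)
    (hL : LocallyLipschitz (f s)) {Ω : Set (Ambient n)} (hΩ : IsOpen Ω)
    (hΩb : Bornology.IsBounded Ω) :
    (∀ᶠ t in 𝓝[≥] (0 : ℝ), IntegrableOn (f (σ V t)) (displace V t '' Ω)) ∧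
    IntegrableOn (fun x => materialDeriv f (σ V) V x + divergence V x * f s x) Ω ∧
    HasDerivWithinAt (fun t => ∫ y in displace V t '' Ω, f (σ V t) y)
      (∫ x in Ω, (materialDeriv f (σ V) V x + divergence V x * f s x)) (Ici 0) 0 := by
  obtain ⟨K, hK, hinj⟩ := exists_bound_fderiv_and_eventually_injective hV hΩb
  obtain ⟨C, hC⟩ :=
    ContinuousLinearMap.exists_abs_abs_det_one_add_smul_sub_one_le (E := Ambient n) K
  refine hf.hasDerivWithinAt_setIntegral hfd hV hσ hL hΩb hΩ.measurableSet hΩb.measure_lt_top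
    (J := fun t x => |(1 + t • fderiv ℝ V x).det|) ?_
    (fun x _ => (ContinuousLinearMap.hasDerivAt_abs_det_one_add_smul _).hasDerivWithinAt)
    (fun x _ => by simp [ContinuousLinearMap.det])
    ⟨C, hC.mono fun t ht x hx => ht _ (hK x hx)⟩ ?_ ?_ ?_
  · refine Eventually.of_forall fun t => Continuous.aestronglyMeasurable ?_
    exact (ContinuousLinearMap.continuous_det.comp
      (continuous_const.add ((hV.continuous_fderiv (by simp)).const_smul t))).abs
  · filter_upwards [hinj] with t ht
    exact hΩ.measurableSet.image_of_continuousOn_injOn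
      (continuous_displace hV.continuous t).continuousOn ht.1
  · filter_upwards [Icc_zero_one_mem_nhdsGE] with t ht
    obtain ⟨R, -, -, -, -, hR⟩ := exists_closedBall_displace hV.continuous hΩb
    exact (Metric.isBounded_closedBall.subset (hR t ht)).measure_lt_top
  · filter_upwards [hinj] with t ht u _
    exact integral_image_eq_integral_abs_det_fderiv_smul volume hΩ.measurableSet
      (fun x _ => (hasStrictFDerivAt_displace hV t x).hasFDerivAt.hasFDerivWithinAt) ht.1 u

theorem ShapeDifferentiable.hasDerivWithinAt_integral_hypersurface
    (hf : ShapeDifferentiable f s σ) (hfd : ∀ s, Differentiable ℝ (f s)) (hV : ContDiff ℝ ∞ V)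
    (hσ : σ V 0 = s) (hL : LocallyLipschitz (f s)) {Γ : Set (Ambient n)}
    (hΓ : IsSmoothHypersurface Γ) (hΓb : Bornology.IsBounded Γ) (hμΓ : μHE[n] Γ < ⊤) :
    (∀ᶠ t in 𝓝[≥] (0 : ℝ), IntegrableOn (f (σ V t)) (displace V t '' Γ) μHE[n]) ∧
    IntegrableOn (fun x => materialDeriv f (σ V) V x + tangentialDivergence Γ V x * f s x) Γ
      μHE[n] ∧
    HasDerivWithinAt (fun t => ∫ y in displace V t '' Γ, f (σ V t) y ∂μHE[n])
      (∫ x in Γ, (materialDeriv f (σ V) V x + tangentialDivergence Γ V x * f s x) ∂μHE[n])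
      (Ici 0) 0 := by
  obtain ⟨K, hK, hinj⟩ := exists_bound_fderiv_and_eventually_injective hV hΓb
  obtain ⟨C, hC⟩ :=
    ContinuousLinearMap.exists_abs_subspaceJacobian_sub_one_le (E := Ambient n) K
  have hcont : ∀ t : ℝ, Continuous fun x => (1 + t • fderiv ℝ V x : Ambient n →L[ℝ] Ambient n) :=
    fun t => continuous_const.add ((hV.continuous_fderiv (by simp)).const_smul t)
  have hb : ∀ᶠ t in 𝓝[≥] (0 : ℝ), ∀ x ∈ Γ,
      |(1 + t • fderiv ℝ V x).subspaceJacobian (tangentSubspace Γ x) - 1| ≤ C * t :=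
    hC.mono fun t ht x hx => ht _ _ (hK x hx)
  refine hf.hasDerivWithinAt_setIntegral hfd hV hσ hL hΓb hΓ.measurableSet hμΓ
    (J := fun t x => (1 + t • fderiv ℝ V x).subspaceJacobian (tangentSubspace Γ x)) ?_
    (fun x _ => (ContinuousLinearMap.hasDerivAt_subspaceJacobian_one_add_smul _ _).hasDerivWithinAt)
    ?_ ⟨C, hb⟩ ?_ ?_ ?_
  · exact Eventually.of_forall fun t =>
      (hΓ.continuousOn_subspaceJacobian (hcont t).continuousOn).aestronglyMeasurable
        hΓ.measurableSet
  · intro x hx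
    -- The filter `𝓝[≥] 0` contains `t = 0`, where the bound `C * t` forces the density to equal
    -- `1`.
    have h1 := hb.self_of_nhdsWithin (self_mem_Ici (a := (0 : ℝ))) x hx
    rw [mul_zero] at h1
    exact sub_eq_zero.1 (abs_nonpos_iff.1 h1)
  · filter_upwards [hinj] with t ht
    exact hΓ.measurableSet.image_of_continuousOn_injOn
      (continuous_displace hV.continuous t).continuousOn ht.1
  -- The image has finite measure because, by the area formula, it is the integral over `Γ` of a
  -- density at most `1 + C * t`.
  · filter_upwards [hinj, hb] with t ht hbt
    rw [hΓ.measure_image_eq_lintegral (fun x _ => hasStrictFDerivAt_displace hV t x)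
      (hcont t).continuousOn ht.2 ht.1 subset_rfl hΓ.measurableSet]
    refine (setLIntegral_mono' (g := fun _ => ENNReal.ofReal (1 + C * t)) hΓ.measurableSet
      fun x hx => ENNReal.ofReal_le_ofReal ?_).trans_lt ?_
    · linarith [(abs_le.1 (hbt x hx)).2]
    · rw [setLIntegral_const]
      exact ENNReal.mul_lt_top ENNReal.ofReal_lt_top hμΓ
  · filter_upwards [hinj] with t ht u hu
    exact hΓ.setIntegral_image (continuous_displace hV.continuous t)
      (fun x _ => hasStrictFDerivAt_displace hV t x) (hcont t).continuousOn ht.2 ht.1 hu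

theorem Emb.perturb_zero {H : Type*} [TopologicalSpace H]
    {I : ModelWithCorners ℝ (EuclideanSpace ℝ (Fin n)) H} {M : Type*} [TopologicalSpace M]
    [ChartedSpace H M] (φ : Emb I M) (V : Ambient n → Ambient n) : φ.perturb V 0 = φ := by
  have h : (fun p => φ.toFun p + (0 : ℝ) • V (φ.toFun p)) = φ.toFun := by
    funext p
    simp
  rw [Emb.perturb, dif_pos (by rw [h]; exact φ.isEmb)]
  simp only [h]

theorem Shape.perturb_zero {H : Type*} [TopologicalSpace H]
    {I : ModelWithCorners ℝ (EuclideanSpace ℝ (Fin n)) H} {M : Type*} [TopologicalSpace M]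
    [ChartedSpace H M] [IsManifold I ∞ M] (B : Shape I M) (V : Ambient n → Ambient n) :
    B.perturb V 0 = B := by
  induction B using Quotient.inductionOn with
  | h φ => exact congrArg Shape.mk (φ.perturb_zero V)

end Perturbation

/-! ### The five rules for a general index set -/

section MaterialCalculus

variable {n : ℕ} {V : Ambient n → Ambient n} {S : Type*} {f g : S → Ambient n → ℝ} {s : S}
  {σ : (Ambient n → Ambient n) → ℝ → S} {h : ℝ → ℝ}

/-- The rules of material calculus for families indexed by an arbitrary set `S`. -/
theorem materialDeriv_rules (hV : ContDiff ℝ ∞ V) (hh : Differentiable ℝ h) (hσ : σ V 0 = s)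
    (hf : ShapeDifferentiable f s σ) (hg : ShapeDifferentiable g s σ)
    (hfd : ∀ s, Differentiable ℝ (f s)) (hgd : ∀ s, Differentiable ℝ (g s)) :
    (∀ x, HasMaterialDeriv f (σ V) V x
      (shapeDeriv f (σ V) x + inner ℝ (gradient (f s) x) (V x))) ∧
    (∀ x, HasMaterialDeriv (fun ψ y => f ψ y * g ψ y) (σ V) V x
      (materialDeriv f (σ V) V x * g s x + f s x * materialDeriv g (σ V) V x)) ∧
    (∀ x, HasMaterialDeriv (fun ψ y => h (f ψ y)) (σ V) V x
      (deriv h (f s x) * materialDeriv f (σ V) V x)) ∧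
    (LocallyLipschitz (f s) → ∀ Ω : Set (Ambient n), IsLipschitzDomain Ω →
      (∀ᶠ t in 𝓝[≥] (0 : ℝ), IntegrableOn (f (σ V t)) (displace V t '' Ω)) ∧
      IntegrableOn (fun x => materialDeriv f (σ V) V x + divergence V x * f s x) Ω ∧
      HasDerivWithinAt (fun t => ∫ y in displace V t '' Ω, f (σ V t) y)
        (∫ x in Ω, (materialDeriv f (σ V) V x + divergence V x * f s x)) (Ici 0) 0) ∧
    (LocallyLipschitz (f s) → ∀ Γ : Set (Ambient n), IsSmoothHypersurface Γ →
      Bornology.IsBounded Γ → μHE[n] Γ < ⊤ →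
      (∀ᶠ t in 𝓝[≥] (0 : ℝ), IntegrableOn (f (σ V t)) (displace V t '' Γ) μHE[n]) ∧
      IntegrableOn (fun x => materialDeriv f (σ V) V x + tangentialDivergence Γ V x * f s x) Γ
        μHE[n] ∧
      HasDerivWithinAt (fun t => ∫ y in displace V t '' Γ, f (σ V t) y ∂μHE[n])
        (∫ x in Γ, (materialDeriv f (σ V) V x + tangentialDivergence Γ V x * f s x) ∂μHE[n])
        (Ici 0) 0) := by
  have hmf : ∀ x, HasMaterialDeriv f (σ V) V x (materialDeriv f (σ V) V x) := fun x => by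
    have := hf.hasMaterialDeriv hfd hV hσ x
    rwa [← this.materialDeriv] at this
  have hmg : ∀ x, HasMaterialDeriv g (σ V) V x (materialDeriv g (σ V) V x) := fun x => by
    have := hg.hasMaterialDeriv hgd hV hσ x
    rwa [← this.materialDeriv] at this
  refine ⟨hf.hasMaterialDeriv hfd hV hσ, fun x => ?_, fun x => ?_,
    fun hL Ω hΩ => hf.hasDerivWithinAt_integral_domain hfd hV hσ hL hΩ.isOpen hΩ.isBounded,
    fun hL Γ hΓ hΓb hμΓ =>
      hf.hasDerivWithinAt_integral_hypersurface hfd hV hσ hL hΓ hΓb hμΓ⟩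
  · simpa only [hσ] using (hmf x).mul (hmg x)
  · simpa only [hσ] using (hmf x).comp hh

end MaterialCalculus

end PreShape

theorem corollary2p2 {n : ℕ} {H : Type*} [TopologicalSpace H]
    (I : ModelWithCorners ℝ (EuclideanSpace ℝ (Fin n)) H)
    (M : Type*) [TopologicalSpace M] [ChartedSpace H M] [IsManifold I ∞ M]
    [CompactSpace M] [PathConnectedSpace M]
    (V : Ambient n → Ambient n) (hV : ContDiff ℝ ∞ V)
    (h : ℝ → ℝ) (hh : Differentiable ℝ h) :
    -- the rules for families of functions indexed by pre-shapes
    (∀ (f g : Emb I M → Ambient n → ℝ) (φ : Emb I M),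
    ShapeDifferentiable f φ φ.perturb → ShapeDifferentiable g φ φ.perturb →
    (∀ ψ, Differentiable ℝ (f ψ)) → (∀ ψ, Differentiable ℝ (g ψ)) →
    -- (i) decomposition
    (∀ x, HasMaterialDeriv f (φ.perturb V) V x
      (shapeDeriv f (φ.perturb V) x + inner ℝ (gradient (f φ) x) (V x))) ∧
    -- (ii) product rule
    (∀ x, HasMaterialDeriv (fun ψ y => f ψ y * g ψ y) (φ.perturb V) V x
      (materialDeriv f (φ.perturb V) V x * g φ x +
        f φ x * materialDeriv g (φ.perturb V) V x)) ∧
    -- (iii) chain rule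
    (∀ x, HasMaterialDeriv (fun ψ y => h (f ψ y)) (φ.perturb V) V x
      (deriv h (f φ x) * materialDeriv f (φ.perturb V) V x)) ∧
    -- (iv) volume integrals
    (LocallyLipschitz (f φ) → ∀ Ω : Set (Ambient n), IsLipschitzDomain Ω →
      (∀ᶠ t in 𝓝[≥] (0 : ℝ), IntegrableOn (f (φ.perturb V t)) (displace V t '' Ω)) ∧
      IntegrableOn (fun x => materialDeriv f (φ.perturb V) V x + divergence V x * f φ x) Ω ∧
      HasDerivWithinAt (fun t => ∫ y in displace V t '' Ω, f (φ.perturb V t) y)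
        (∫ x in Ω, (materialDeriv f (φ.perturb V) V x + divergence V x * f φ x))
        (Ici 0) 0) ∧
    -- (v) integrals over hypersurfaces
    (LocallyLipschitz (f φ) → ∀ Γ : Set (Ambient n), IsSmoothHypersurface Γ →
      Bornology.IsBounded Γ → μHE[n] Γ < ⊤ →
      (∀ᶠ t in 𝓝[≥] (0 : ℝ), IntegrableOn (f (φ.perturb V t)) (displace V t '' Γ) μHE[n]) ∧
      IntegrableOn (fun x => materialDeriv f (φ.perturb V) V x +
        tangentialDivergence Γ V x * f φ x) Γ μHE[n] ∧
      HasDerivWithinAt (fun t => ∫ y in displace V t '' Γ, f (φ.perturb V t) y ∂μHE[n])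
        (∫ x in Γ, (materialDeriv f (φ.perturb V) V x +
          tangentialDivergence Γ V x * f φ x) ∂μHE[n])
        (Ici 0) 0)) ∧
    -- the special case of shape derivatives: families of functions indexed by shapes
    (∀ (F G : Shape I M → Ambient n → ℝ) (B : Shape I M),
    ShapeDifferentiable F B B.perturb → ShapeDifferentiable G B B.perturb →
    (∀ B', Differentiable ℝ (F B')) → (∀ B', Differentiable ℝ (G B')) →
    -- (i) decomposition
    (∀ x, HasMaterialDeriv F (B.perturb V) V x
      (shapeDeriv F (B.perturb V) x + inner ℝ (gradient (F B) x) (V x))) ∧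
    -- (ii) product rule
    (∀ x, HasMaterialDeriv (fun B' y => F B' y * G B' y) (B.perturb V) V x
      (materialDeriv F (B.perturb V) V x * G B x +
        F B x * materialDeriv G (B.perturb V) V x)) ∧
    -- (iii) chain rule
    (∀ x, HasMaterialDeriv (fun B' y => h (F B' y)) (B.perturb V) V x
      (deriv h (F B x) * materialDeriv F (B.perturb V) V x)) ∧
    -- (iv) volume integrals
    (LocallyLipschitz (F B) → ∀ Ω : Set (Ambient n), IsLipschitzDomain Ω →
      (∀ᶠ t in 𝓝[≥] (0 : ℝ), IntegrableOn (F (B.perturb V t)) (displace V t '' Ω)) ∧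
      IntegrableOn (fun x => materialDeriv F (B.perturb V) V x + divergence V x * F B x) Ω ∧
      HasDerivWithinAt (fun t => ∫ y in displace V t '' Ω, F (B.perturb V t) y)
        (∫ x in Ω, (materialDeriv F (B.perturb V) V x + divergence V x * F B x))
        (Ici 0) 0) ∧
    -- (v) integrals over hypersurfaces
    (LocallyLipschitz (F B) → ∀ Γ : Set (Ambient n), IsSmoothHypersurface Γ →
      Bornology.IsBounded Γ → μHE[n] Γ < ⊤ →
      (∀ᶠ t in 𝓝[≥] (0 : ℝ), IntegrableOn (F (B.perturb V t)) (displace V t '' Γ) μHE[n]) ∧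
      IntegrableOn (fun x => materialDeriv F (B.perturb V) V x +
        tangentialDivergence Γ V x * F B x) Γ μHE[n] ∧
      HasDerivWithinAt (fun t => ∫ y in displace V t '' Γ, F (B.perturb V t) y ∂μHE[n])
        (∫ x in Γ, (materialDeriv F (B.perturb V) V x +
          tangentialDivergence Γ V x * F B x) ∂μHE[n])
        (Ici 0) 0)) := by
  exact ⟨fun f g φ hf hg hfd hgd =>
      materialDeriv_rules hV hh (φ.perturb_zero V) hf hg hfd hgd,
    fun F G B hF hG hFd hGd =>
      materialDeriv_rules hV hh (B.perturb_zero V) hF hG hFd hGd⟩
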